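/- Notation. A lattice polytope in $\mathbb R^2$ is the convex hull of a non-empty finite set of points of $\mathbb Z^2$, and $\mathcal P(\mathbb Z^2)$ is the family of all lattice polytopes. If $P,Q\in\mathcal P(\mathbb Z^2)$ and $P\cup Q$ is convex, then $P\cup Q,\,P\cap Q\in\mathcal P(\mathbb Z^2)$. Let $\mathcal M(\mathbb R^2)$ be the set of Lebesgue measurable functions $\mathbb R^2\to\mathbb R$ (functions, not classes modulo almost everywhere equality). A map $Z:\mathcal P(\mathbb Z^2)\to\mathcal M(\mathbb R^2)$ is - a valuation if $Z(P\cup Q)+Z(P\cap Q)=Z(P)+Z(Q)$ whenever $P,Q\in\mathcal P(\mathbb Z^2)$ and $P\cup Q$ is convex; - simple if $Z(P)=0$ for every $P\in\mathcal P(\mathbb Z^2)$ with $\dim P\le 1$; - $\mathcal G(\mathbb Z^2)$ covariant if $Z(\Phi P+a)(x)=e^{\langle a,x\rangle}\,Z(P)(\Phi^{T}x)$ for all $\Phi\in\mathrm{GL}(2,\mathbb Z)$, $a\in\mathbb Z^2$, $P\in\mathcal P(\mathbb Z^2)$ and $x\in\mathbb R^2$; equivalently, if $Z$ is translatively exponential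 (the case $\Phi=I$) and $\mathrm{GL}(2,\mathbb Z)$ covariant (the case $a=o$). Let $T$ be the triangle with vertices $e_1=(1,0)$, $e_2=(0,1)$ and $o=(0,0)$. Proposition. Let $f_2\in\mathcal M(\mathbb R^2)$ satisfy, for all $x,y\in\mathbb R$, \begin{align*} f_2(-x+y,-x)&=e^{-x}f_2(x,y),\\ f_2(x,y)+e^{x+y}f_2(-x,-y)&=f_2(x,x+y)+f_2(x+y,y),\\ f_2(x,y)&=f_2(y,x). \end{align*} Then there exists a unique simple $\mathcal G(\mathbb Z^2)$ covariant valuation $Z:\mathcal P(\mathbb Z^2)\to\mathcal M(\mathbb R^2)$ such that $Z(T)=f_2$. -/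

import Mathlib

open MeasureTheory Matrix

/-- The plane `ℝ²`. Only its linear, topological and measure-theoretic structure is used; the
inner product of `x` and `y` is written `x ⬝ᵥ y`. -/
abbrev Plane : Type := Fin 2 → ℝ

/-- The point of `ℝ²` given by a point of `ℤ²`. -/
def latticePoint (z : Fin 2 → ℤ) : Plane := fun i => (z i : ℝ)

/-- A lattice polytope: the convex hull of finitely many (at least one) points of `ℤ²`. -/
def IsLatticePolytope (P : Set Plane) : Prop :=
  ∃ s : Finset (Fin 2 → ℤ), s.Nonempty ∧ P = convexHull ℝ (latticePoint '' (s : Set (Fin 2 → ℤ)))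

/-- The family `𝒫(ℤ²)` of all lattice polytopes in `ℝ²` (points, segments and polygons). -/
abbrev LatticePolytope : Type := {P : Set Plane // IsLatticePolytope P}

theorem IsLatticePolytope.convex {P : Set Plane} (hP : IsLatticePolytope P) : Convex ℝ P := by
  obtain ⟨s, -, rfl⟩ := hP
  exact convex_convexHull ℝ _

theorem IsLatticePolytope.nonempty {P : Set Plane} (hP : IsLatticePolytope P) : P.Nonempty := by
  obtain ⟨s, hs, rfl⟩ := hP
  exact (hs.to_set.image _).convexHull

theorem IsLatticePolytope.isCompact {P : Set Plane} (hP : IsLatticePolytope P) : IsCompact P := by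
  obtain ⟨s, -, rfl⟩ := hP
  exact (s.finite_toSet.image latticePoint).isCompact_convexHull (𝕜 := ℝ)

theorem IsLatticePolytope.isClosed {P : Set Plane} (hP : IsLatticePolytope P) : IsClosed P :=
  hP.isCompact.isClosed

/-- If the union of two closed convex sets is convex, then every extreme point of the intersection
is an extreme point of one of them. -/
theorem extremePoints_inter_subset_of_convex_union {P Q : Set Plane} (hPc : Convex ℝ P)
    (hQc : Convex ℝ Q) (hP : IsClosed P) (hQ : IsClosed Q) (h : Convex ℝ (P ∪ Q)) :
    (P ∩ Q).extremePoints ℝ ⊆ P.extremePoints ℝ ∪ Q.extremePoints ℝ := by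
  -- a non-extreme point of `A` that is extreme in `A ∩ B` lies inside a segment of `A`
  -- one half of which avoids `B`
  have key : ∀ {A B : Set Plane}, Convex ℝ A → Convex ℝ B → ∀ {x : Plane},
      x ∈ (A ∩ B).extremePoints ℝ → x ∉ A.extremePoints ℝ →
      ∃ u : Plane, x + u ∈ A ∧ (∃ r : ℝ, 0 < r ∧ x - r • u ∈ A) ∧
        ∀ t : ℝ, 0 < t → x + t • u ∈ A → x + t • u ∉ B := by
    intro A B hA hB x hx hxA
    have hx' := mem_extremePoints.1 hx
    have hxn : ∃ a ∈ A, ∃ b ∈ A, x ∈ openSegment ℝ a b ∧ ¬ (a = x ∧ b = x) := by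
      by_contra hcon
      push Not at hcon
      exact hxA (mem_extremePoints.2 ⟨hx.1.1, fun a ha b hb hab => hcon a ha b hb hab⟩)
    obtain ⟨a, ha, b, hb, ⟨p, q, hp, hq, hpq, hxe⟩, hne⟩ := hxn
    have hw : ∀ s t : ℝ, 0 < s → 0 < t → ∀ w : Plane,
        x + s • w ∈ A ∩ B → x - t • w ∈ A ∩ B → w = 0 := by
      intro s t hs ht w h1 h2
      have := (hx'.2 _ h1 _ h2 ⟨t / (s + t), s / (s + t), by positivity, by positivity,
        by field_simp; ring, by
          ext i
          simp only [Pi.add_apply, Pi.smul_apply, Pi.sub_apply, smul_eq_mul]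
          field_simp
          ring⟩).1
      have h3 : s • w = 0 := by simpa using this
      exact (smul_eq_zero.1 h3).resolve_left hs.ne'
    have hqp : q = 1 - p := by linarith
    have hxa : x - (p / q) • (a - x) = b := by
      subst hxe
      ext i
      simp only [Pi.add_apply, Pi.smul_apply, Pi.sub_apply, smul_eq_mul]
      field_simp
      rw [hqp]
      ring
    have hxb : x - (q / p) • (b - x) = a := by
      subst hxe
      ext i
      simp only [Pi.add_apply, Pi.smul_apply, Pi.sub_apply, smul_eq_mul]
      field_simp
      rw [hqp]
      ring
    by_cases hside : ∀ t : ℝ, 0 < t → x + t • (b - x) ∈ A → x + t • (b - x) ∉ B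
    · exact ⟨b - x, by simpa using hb, ⟨q / p, by positivity, by rwa [hxb]⟩, hside⟩
    · push Not at hside
      obtain ⟨t, ht, htA, htB⟩ := hside
      refine ⟨a - x, by simpa using ha, ⟨p / q, by positivity, by rwa [hxa]⟩, ?_⟩
      intro s hs hsA hsB
      have hax : a - x = - ((q / p) • (b - x)) := by
        nth_rewrite 1 [← hxb]
        abel
      have hbx : b - x = 0 := by
        refine hw t (s * (q / p)) ht (by positivity) (b - x) ⟨htA, htB⟩ ?_
        have : x - (s * (q / p)) • (b - x) = x + s • (a - x) := by
          rw [hax, smul_neg, smul_smul]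
          abel
        rw [this]
        exact ⟨hsA, hsB⟩
      exact hne ⟨by rw [← sub_eq_zero, hax, hbx]; simp, sub_eq_zero.1 hbx⟩
  intro x hx
  by_contra hcon
  simp only [Set.mem_union, not_or] at hcon
  obtain ⟨u, huP, ⟨r, hr, hruP⟩, huQ⟩ := key hPc hQc hx hcon.1
  obtain ⟨v, hvQ, -, hvP⟩ := key hQc hPc (by rwa [Set.inter_comm]) hcon.2
  have hvP' : ∀ t : ℝ, 0 < t → t ≤ 1 → x + t • v ∉ P := by
    intro t ht ht1
    refine hvP t ht ?_
    have := hQc hx.1.2 hvQ (sub_nonneg.2 ht1) ht.le (by ring)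
    convert this using 1
    ext i
    simp only [Pi.add_apply, Pi.smul_apply, smul_eq_mul]
    ring
  have hseg : segment ℝ (x + u) (x + v) ⊆ P ∪ Q :=
    h.segment_subset (Or.inl huP) (Or.inr hvQ)
  obtain ⟨m, ⟨p, q, hp, hq, hpq, rfl⟩, hmP, hmQ⟩ :=
    isPreconnected_closed_iff.1 (convex_segment (𝕜 := ℝ) (x + u) (x + v)).isPreconnected
      P Q hP hQ hseg ⟨_, left_mem_segment ℝ _ _, huP⟩ ⟨_, right_mem_segment ℝ _ _, hvQ⟩
  rcases hq.eq_or_lt with rfl | hq0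
  · have hp1 : p = 1 := by linarith
    subst hp1
    have h1 := huQ 1 one_pos (by simpa using huP)
    exact h1 (by simpa using hmQ)
  · have hpr : 0 < p + r := by positivity
    have hmem := hPc hmP hruP (a := r / (p + r)) (b := p / (p + r)) (by positivity)
      (by positivity) (by field_simp; ring)
    refine hvP' (r * q / (p + r)) (by positivity) ?_ ?_
    · rw [div_le_one hpr]
      nlinarith
    · convert hmem using 1
      ext i
      have hqp : q = 1 - p := by linarith
      simp only [Pi.add_apply, Pi.smul_apply, Pi.sub_apply, smul_eq_mul]
      field_simp
      rw [hqp]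
      ring

theorem IsLatticePolytope.extremePoints_subset {P : Set Plane} (hP : IsLatticePolytope P) :
    P.extremePoints ℝ ⊆ Set.range latticePoint ∧ (P.extremePoints ℝ).Finite := by
  obtain ⟨s, -, rfl⟩ := hP
  have h := extremePoints_convexHull_subset (𝕜 := ℝ)
    (A := latticePoint '' (s : Set (Fin 2 → ℤ)))
  exact ⟨h.trans (Set.image_subset_range _ _), (s.finite_toSet.image _).subset h⟩

/-- The union of two lattice polytopes is a lattice polytope as soon as it is convex. -/
theorem IsLatticePolytope.union {P Q : Set Plane} (hP : IsLatticePolytope P)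
    (hQ : IsLatticePolytope Q) (h : Convex ℝ (P ∪ Q)) : IsLatticePolytope (P ∪ Q) := by
  classical
  obtain ⟨s, hs, rfl⟩ := hP
  obtain ⟨t, ht, rfl⟩ := hQ
  refine ⟨s ∪ t, hs.mono Finset.subset_union_left, ?_⟩
  rw [Finset.coe_union, Set.image_union]
  apply Set.Subset.antisymm
  · exact Set.union_subset (convexHull_mono Set.subset_union_left)
      (convexHull_mono Set.subset_union_right)
  · exact convexHull_min (Set.union_subset_union (subset_convexHull ℝ _) (subset_convexHull ℝ _)) h

/-- The intersection of two lattice polytopes with convex union is a lattice polytope. -/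
theorem IsLatticePolytope.inter {P Q : Set Plane} (hP : IsLatticePolytope P)
    (hQ : IsLatticePolytope Q) (h : Convex ℝ (P ∪ Q)) : IsLatticePolytope (P ∩ Q) := by
  classical
  have hne : (P ∩ Q).Nonempty := by
    obtain ⟨p, hp⟩ := hP.nonempty
    obtain ⟨q, hq⟩ := hQ.nonempty
    obtain ⟨m, -, hm⟩ := isPreconnected_closed_iff.1 h.isPreconnected P Q hP.isClosed hQ.isClosed
      subset_rfl ⟨p, Or.inl hp, hp⟩ ⟨q, Or.inr hq, hq⟩
    exact ⟨m, hm⟩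
  have hsub := extremePoints_inter_subset_of_convex_union hP.convex hQ.convex hP.isClosed
    hQ.isClosed h
  have hfin : ((P ∩ Q).extremePoints ℝ).Finite :=
    (hP.extremePoints_subset.2.union hQ.extremePoints_subset.2).subset hsub
  have hcpt : IsCompact (P ∩ Q) := hP.isCompact.inter hQ.isCompact
  have hhull : convexHull ℝ ((P ∩ Q).extremePoints ℝ) = P ∩ Q := by
    have := closure_convexHull_extremePoints hcpt (hP.convex.inter hQ.convex)
    rwa [(hfin.isCompact_convexHull (𝕜 := ℝ)).isClosed.closure_eq] at this
  have hlat : (P ∩ Q).extremePoints ℝ ⊆ Set.range latticePoint :=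
    hsub.trans (Set.union_subset hP.extremePoints_subset.1 hQ.extremePoints_subset.1)
  have hinj : Function.Injective latticePoint := fun a b hab => by
    ext i
    have := congrFun hab i
    simpa [latticePoint] using this
  have hfin' := hfin.preimage hinj.injOn (f := latticePoint)
  have himg : latticePoint '' (hfin'.toFinset : Set (Fin 2 → ℤ)) = (P ∩ Q).extremePoints ℝ := by
    rw [hfin'.coe_toFinset, Set.image_preimage_eq_of_subset hlat]
  refine ⟨hfin'.toFinset, ?_, by rw [himg, hhull]⟩
  rw [← Finset.coe_nonempty, ← Set.image_nonempty (f := latticePoint), himg,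
    ← convexHull_nonempty_iff (𝕜 := ℝ), hhull]
  exact hne

/-- The affine lattice automorphism `x ↦ Φ x + a` of `ℤ²`, acting on `ℝ²`. As `Φ` runs through
`GL(2, ℤ)` and `a` through `ℤ²`, these maps are all the elements of the group `𝒢(ℤ²)`. -/
def latticeAffine (Φ : GL (Fin 2) ℤ) (a : Fin 2 → ℤ) (x : Plane) : Plane :=
  (Φ.val.map (Int.cast : ℤ → ℝ)) *ᵥ x + latticePoint a

theorem IsLatticePolytope.image_latticeAffine {P : Set Plane} (hP : IsLatticePolytope P)
    (Φ : GL (Fin 2) ℤ) (a : Fin 2 → ℤ) : IsLatticePolytope (latticeAffine Φ a '' P) := by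
  classical
  obtain ⟨s, hs, rfl⟩ := hP
  refine ⟨s.image (fun z => Φ.val *ᵥ z + a), hs.image _, ?_⟩
  let g : Plane →ᵃ[ℝ] Plane :=
    (Matrix.mulVecLin (Φ.val.map (Int.cast : ℤ → ℝ))).toAffineMap +
      AffineMap.const ℝ Plane (latticePoint a)
  have hg : ⇑g = latticeAffine Φ a := by
    ext x i
    simp [g, latticeAffine]
  rw [← hg, g.image_convexHull, hg, Finset.coe_image, Set.image_image, Set.image_image]
  congr 1
  refine Set.image_congr fun z _ => ?_
  ext i
  fin_cases i <;> simp [latticeAffine, latticePoint]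

namespace LatticePolytope

/-- The union of two lattice polytopes whose union is convex. -/
def union (P Q : LatticePolytope) (h : Convex ℝ (P.1 ∪ Q.1)) : LatticePolytope :=
  ⟨P.1 ∪ Q.1, P.2.union Q.2 h⟩

/-- The intersection of two lattice polytopes whose union is convex. -/
def inter (P Q : LatticePolytope) (h : Convex ℝ (P.1 ∪ Q.1)) : LatticePolytope :=
  ⟨P.1 ∩ Q.1, P.2.inter Q.2 h⟩

/-- The image of a lattice polytope under `x ↦ Φ x + a`. -/
def image (Φ : GL (Fin 2) ℤ) (a : Fin 2 → ℤ) (P : LatticePolytope) : LatticePolytope :=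
  ⟨latticeAffine Φ a '' P.1, P.2.image_latticeAffine Φ a⟩

/-- The standard triangle `T = [e₁, e₂, o]`. -/
def standardTriangle : LatticePolytope :=
  ⟨convexHull ℝ {![1, 0], ![0, 1], ![0, 0]}, {![1, 0], ![0, 1], ![0, 0]}, by simp, by
    congr 1
    simp only [Finset.coe_insert, Finset.coe_singleton, Set.image_insert_eq, Set.image_singleton]
    congr! 1 <;> [skip; congr! 1] <;>
      simp [latticePoint, funext_iff, Fin.forall_fin_two, Set.ext_iff]⟩

end LatticePolytope

/-- `ℳ(ℝ²)`: the real-valued Lebesgue measurable functions on `ℝ²`, that is, the functions under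
which the preimage of every Borel set is Lebesgue measurable. These are functions, not classes
modulo almost everywhere equality. -/
abbrev LebesgueMeasurableFun : Type :=
  {f : Plane → ℝ // NullMeasurable f (volume : Measure Plane)}

/-- `Z : 𝒫(ℤ²) → ℳ(ℝ²)` is a valuation: `Z(P ∪ Q) + Z(P ∩ Q) = Z(P) + Z(Q)` whenever `P ∪ Q` is
convex. -/
def IsValuation (Z : LatticePolytope → LebesgueMeasurableFun) : Prop :=
  ∀ (P Q : LatticePolytope) (h : Convex ℝ (P.1 ∪ Q.1)) (x : Plane),
    (Z (P.union Q h)).1 x + (Z (P.inter Q h)).1 x = (Z P).1 x + (Z Q).1 x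

/-- `Z` is simple: `Z(P) = 0` whenever `dim P ≤ 1`, where `dim P` is the dimension of the affine
hull of `P`. -/
def IsSimple (Z : LatticePolytope → LebesgueMeasurableFun) : Prop :=
  ∀ P : LatticePolytope, Module.finrank ℝ (vectorSpan ℝ P.1) ≤ 1 → ∀ x : Plane, (Z P).1 x = 0

/-- The action of the affine map `x ↦ Φ x + a` on functions: it sends `f` to the function
`x ↦ e^{⟨a, x⟩} f(Φᵀ x)`. -/
noncomputable def affineAct (Φ : GL (Fin 2) ℤ) (a : Fin 2 → ℤ) (f : Plane → ℝ) (x : Plane) : ℝ :=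
  Real.exp (latticePoint a ⬝ᵥ x) * f ((Φ.val.map (Int.cast : ℤ → ℝ))ᵀ *ᵥ x)

/-- `Z` is `𝒢(ℤ²)` covariant: `Z(Ξ P) = Ξ · Z(P)` for every affine automorphism `Ξ` of `ℤ²`. -/
def IsAffineCovariant (Z : LatticePolytope → LebesgueMeasurableFun) : Prop :=
  ∀ (Φ : GL (Fin 2) ℤ) (a : Fin 2 → ℤ) (P : LatticePolytope) (x : Plane),
    (Z (LatticePolytope.image Φ a P)).1 x = affineAct Φ a (Z P).1 x

/-! Everything happens at one point x at a time, where Z becomes a real-valued simple valuation with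
prescribed values on the images of T under affine lattice automorphisms.

Uniqueness rests on unimodular triangulations. A lattice polygon is cut along diagonals into
triangles, and a lattice triangle is subdivided at lattice points until all pieces have normalized
area one or zero (`IsLatticePolytope.hasTriangulation`). The resulting list of triangles does not
depend on the valuation, so a simple valuation is determined by its values on unimodular triangles
(`IsSimpleValuation.eq_of_eq_unimodular`). This also yields covariance, by comparing two valuations
on such triangles, and measurability, since Z(P) is one finite sum of transforms of f₂ for all x.

For existence at x ≠ 0 the valuation is written as a sum over the boundary, so that no comparison of
different triangulations is needed. Give every primitive vector v a number e(v) with e(-v) =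
-exp(-⟨v,x⟩) e(v), and let the segment from p to p + v contribute exp(⟨p,x⟩) e(v). The sum over the
counterclockwise boundary is a simple valuation (`isSimpleValuation_boundarySum`): the ends of edges
are lexicographic maxima, every function of which is a valuation, and a degenerate polygon is
traversed once in each direction. Its values on unimodular triangles are the prescribed ones as soon
as e(u) + exp(⟨u,x⟩) e(w) - e(u+w) = f₂(⟨u,x⟩, ⟨u+w,x⟩) whenever det(u,w) = 1.

To solve this cocycle equation, choose e(e₁) and e(e₂) so that the boundary sum of the unit square
equals the sum of the values of its two triangles (`SquareCompatible`); this is a single linear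
equation, solvable for x ≠ 0. The remaining values are then forced by the Euclidean algorithm. The
functional equations of f₂ carry the compatibility from one unimodular parallelogram to the next,
which proves the cocycle equation in a quadrant (`coneValue_spec`) and then everywhere
(`edgeValue_spec`). At x = 0 all exponentials are 1, and a multiple of area does the job. -/

/-! ### Signed area and real-valued simple valuations -/

/-- The signed area of the parallelogram spanned by `u` and `v`. -/
def cross {R : Type*} [CommRing R] (u v : Fin 2 → R) : R := u 0 * v 1 - u 1 * v 0

/-- The linear functional `v ↦ cross u v`. -/
def crossLin (u : Plane) : Plane →ₗ[ℝ] ℝ where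
  toFun v := cross u v
  map_add' v w := by simp [cross]; ring
  map_smul' r v := by simp [cross]; ring

@[simp] theorem crossLin_apply (u v : Plane) : crossLin u v = cross u v := rfl

theorem crossLin_ne_zero {u : Plane} (hu : u ≠ 0) : crossLin u ≠ 0 := by
  intro h
  apply hu
  have h0 := LinearMap.congr_fun h ![1, 0]
  have h1 := LinearMap.congr_fun h ![0, 1]
  simp [cross] at h0 h1
  ext i
  fin_cases i <;> simp [h0, h1]

theorem collinear_of_cross_eq_zero {a b y : Plane} (h : cross (b - a) (y - a) = 0) :
    Collinear ℝ {a, b, y} := by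
  by_cases hab : b = a
  · subst hab
    simpa using collinear_pair ℝ b y
  rw [collinear_iff_of_mem (p₀ := a) (by simp)]
  refine ⟨b - a, ?_⟩
  simp only [cross, Pi.sub_apply] at h
  have hne : b 0 - a 0 ≠ 0 ∨ b 1 - a 1 ≠ 0 := by
    by_contra hcon
    push Not at hcon
    apply hab
    ext i
    fin_cases i
    · simpa using sub_eq_zero.1 hcon.1
    · simpa using sub_eq_zero.1 hcon.2
  have hy : ∃ r : ℝ, y = r • (b - a) + a := by
    rcases hne with h0 | h0
    · refine ⟨(y 0 - a 0) / (b 0 - a 0), ?_⟩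
      ext i
      fin_cases i
      · simp; field_simp; ring
      · simp; field_simp; linarith
    · refine ⟨(y 1 - a 1) / (b 1 - a 1), ?_⟩
      ext i
      fin_cases i
      · simp; field_simp; linarith
      · simp; field_simp; ring
  rintro p (rfl | rfl | rfl)
  · exact ⟨0, by simp⟩
  · exact ⟨1, by simp⟩
  · simpa using hy

/-- A real-valued simple valuation on lattice polytopes. -/
structure IsSimpleValuation (z : Set Plane → ℝ) : Prop where
  union_add_inter : ∀ P Q : Set Plane, IsLatticePolytope P → IsLatticePolytope Q →
    Convex ℝ (P ∪ Q) → z (P ∪ Q) + z (P ∩ Q) = z P + z Q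
  simple : ∀ P : Set Plane, IsLatticePolytope P → Module.finrank ℝ (vectorSpan ℝ P) ≤ 1 → z P = 0

theorem finrank_vectorSpan_le_one {ℓ : Plane →ₗ[ℝ] ℝ} (hℓ : ℓ ≠ 0) {c : ℝ} {S : Set Plane}
    (hS : ∀ y ∈ S, ℓ y = c) : Module.finrank ℝ (vectorSpan ℝ S) ≤ 1 := by
  have hle : vectorSpan ℝ S ≤ LinearMap.ker ℓ := by
    rw [vectorSpan_def, Submodule.span_le]
    rintro _ ⟨a, ha, b, hb, rfl⟩
    simp [hS a ha, hS b hb]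
  have hker : Module.finrank ℝ (LinearMap.ker ℓ) = 1 := by
    have h1 := LinearMap.finrank_range_add_finrank_ker ℓ
    have h2 : Module.finrank ℝ (LinearMap.range ℓ) = 1 := by
      rw [LinearMap.range_eq_top.2 (LinearMap.surjective hℓ)]
      simp
    rw [h2] at h1
    simp at h1
    omega
  exact hker ▸ Submodule.finrank_mono hle

theorem exists_functional_of_finrank_le_one {S : Set Plane}
    (hS : Module.finrank ℝ (vectorSpan ℝ S) ≤ 1) :
    ∃ u : Plane, u ≠ 0 ∧ ∀ a ∈ S, ∀ b ∈ S, cross u (b - a) = 0 := by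
  rw [finrank_le_one_iff] at hS
  obtain ⟨⟨v, hv⟩, hS⟩ := hS
  have key : ∀ a ∈ S, ∀ b ∈ S, cross v (b - a) = 0 := by
    intro a ha b hb
    obtain ⟨c, hc⟩ := hS ⟨b - a, vsub_mem_vectorSpan ℝ hb ha⟩
    have hc' : c • v = b - a := congrArg Subtype.val hc
    rw [← hc']
    simp [cross]; ring
  -- The vector space spanned by a single point is zero; any nonzero vector then serves.
  by_cases hv0 : v = 0
  · refine ⟨![1, 0], fun h => by simpa using congrFun h 0, fun a ha b hb => ?_⟩
    obtain ⟨c, hc⟩ := hS ⟨b - a, vsub_mem_vectorSpan ℝ hb ha⟩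
    have hc' : c • v = b - a := congrArg Subtype.val hc
    rw [← hc', hv0]
    simp [cross]
  · exact ⟨v, hv0, key⟩

theorem isLatticePolytope_convexHull {S : Set Plane} (hf : S.Finite) (hn : S.Nonempty)
    (hS : S ⊆ Set.range latticePoint) : IsLatticePolytope (convexHull ℝ S) := by
  classical
  have hinj : Function.Injective latticePoint := fun a b hab => by
    ext i
    simpa [latticePoint] using congrFun hab i
  obtain ⟨t, rfl⟩ := Set.subset_range_iff_exists_image_eq.1 hS
  have ht : t.Finite := hf.of_finite_image hinj.injOn
  refine ⟨ht.toFinset, ?_, by simp⟩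
  simpa using hn

/-! ### Cutting polygons along lattice segments -/

namespace IsSimpleValuation

variable {z : Set Plane → ℝ}

theorem convexHull_eq_zero (hz : IsSimpleValuation z) {ℓ : Plane →ₗ[ℝ] ℝ} (hℓ : ℓ ≠ 0) {c : ℝ}
    {S : Set Plane} (hS : IsLatticePolytope (convexHull ℝ S)) (h : ∀ y ∈ S, ℓ y = c) :
    z (convexHull ℝ S) = 0 := by
  refine hz.simple _ hS (finrank_vectorSpan_le_one hℓ (c := c) ?_)
  have hc : Convex ℝ {y | ℓ y = c} := convex_hyperplane ℓ.isLinear c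
  exact fun y hy => convexHull_min h hc hy

/-- Cutting a lattice polytope along a line. -/
theorem convexHull_union_eq_add (hz : IsSimpleValuation z) {ℓ : Plane →ₗ[ℝ] ℝ} (hℓ : ℓ ≠ 0)
    {c : ℝ} {S T : Set Plane} (hS : IsLatticePolytope (convexHull ℝ S))
    (hT : IsLatticePolytope (convexHull ℝ T)) (hSc : ∀ y ∈ S, c ≤ ℓ y) (hTc : ∀ y ∈ T, ℓ y ≤ c)
    (hcut : ∀ y ∈ convexHull ℝ (S ∪ T), ℓ y = c → y ∈ convexHull ℝ S ∧ y ∈ convexHull ℝ T) :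
    z (convexHull ℝ (S ∪ T)) = z (convexHull ℝ S) + z (convexHull ℝ T) := by
  have hSc' : ∀ y ∈ convexHull ℝ S, c ≤ ℓ y := fun y hy =>
    convexHull_min (t := {y | c ≤ ℓ y}) hSc (convex_halfSpace_ge ℓ.isLinear c) hy
  have hTc' : ∀ y ∈ convexHull ℝ T, ℓ y ≤ c := fun y hy =>
    convexHull_min (t := {y | ℓ y ≤ c}) hTc (convex_halfSpace_le ℓ.isLinear c) hy
  have hSn : S.Nonempty := convexHull_nonempty_iff.1 hS.nonempty
  have hTn : T.Nonempty := convexHull_nonempty_iff.1 hT.nonempty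
  have hunion : convexHull ℝ (S ∪ T) = convexHull ℝ S ∪ convexHull ℝ T := by
    refine Set.Subset.antisymm (fun x hx => ?_) (Set.union_subset
      (convexHull_mono Set.subset_union_left) (convexHull_mono Set.subset_union_right))
    have hx' := hx
    rw [convexHull_union hSn hTn, mem_convexJoin] at hx'
    obtain ⟨a, ha, b, hb, hxab⟩ := hx'
    -- The segment from `a` to `b` crosses the line at `y`, which `hcut` puts into both hulls; so
    -- each of its two halves stays in one hull.
    obtain ⟨y, hy, hyc⟩ : ∃ y ∈ segment ℝ a b, ℓ y = c := by
      have himg := image_segment ℝ ℓ.toAffineMap a b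
      have hc : c ∈ segment ℝ (ℓ a) (ℓ b) := by
        rw [segment_symm, segment_eq_Icc ((hTc' b hb).trans (hSc' a ha))]
        exact ⟨hTc' b hb, hSc' a ha⟩
      have : c ∈ ℓ.toAffineMap '' segment ℝ a b := by rw [himg]; exact hc
      exact this
    have hyh := hcut y ((convex_convexHull ℝ _).segment_subset
      (convexHull_mono Set.subset_union_left ha) (convexHull_mono Set.subset_union_right hb) hy) hyc
    have hw : Wbtw ℝ a x y ∨ Wbtw ℝ y x b := by
      rw [mem_segment_iff_wbtw] at hy hxab
      have htot : Wbtw ℝ a y x ∨ Wbtw ℝ a x y := by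
        obtain ⟨r, hr, rfl⟩ := id hy
        obtain ⟨q, hq, rfl⟩ := id hxab
        exact wbtw_or_wbtw_smul_vadd_of_nonneg a (b -ᵥ a) hr.1 hq.1
      rcases htot with h | h
      · exact Or.inr (hxab.trans_left_right h)
      · exact Or.inl h
    rcases hw with h | h
    · exact Or.inl ((convex_convexHull ℝ S).segment_subset ha hyh.1 (mem_segment_iff_wbtw.2 h))
    · exact Or.inr ((convex_convexHull ℝ T).segment_subset hyh.2 hb (mem_segment_iff_wbtw.2 h))
  have hconv : Convex ℝ (convexHull ℝ S ∪ convexHull ℝ T) := hunion ▸ convex_convexHull ℝ _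
  have h0 : z (convexHull ℝ S ∩ convexHull ℝ T) = 0 :=
    hz.simple _ (hS.inter hT hconv) (finrank_vectorSpan_le_one hℓ (c := c)
      fun y hy => le_antisymm (hTc' y hy.2) (hSc' y hy.1))
  rw [hunion, ← hz.union_add_inter _ _ hS hT hconv, h0, add_zero]

end IsSimpleValuation

theorem isLatticePolytope_triangle {a b c : Plane} (ha : a ∈ Set.range latticePoint)
    (hb : b ∈ Set.range latticePoint) (hc : c ∈ Set.range latticePoint) :
    IsLatticePolytope (convexHull ℝ {a, b, c}) := by
  refine isLatticePolytope_convexHull (by simp) (by simp) ?_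
  rintro x (rfl | rfl | rfl) <;> assumption

theorem convexHull_insert_of_mem {x : Plane} {S : Set Plane} (hx : x ∈ convexHull ℝ S) :
    convexHull ℝ (insert x S) = convexHull ℝ S :=
  (convexHull_min (Set.insert_subset hx (subset_convexHull ℝ S)) (convex_convexHull ℝ S)).antisymm
    (convexHull_mono (Set.subset_insert x S))

/-- Treats the flat quadrilaterals. The common line is that through `b` and `c`, or that through `p`
and `d` if `b = c`, or any line through the point if all four coincide. -/
theorem exists_ne_zero_cross_eq {p d b c m : Plane} (hm : m ∈ segment ℝ p d)
    (hm' : m ∈ segment ℝ b c) (hp : cross (c - b) p = cross (c - b) b)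
    (hd : cross (c - b) d = cross (c - b) b) :
    ∃ u : Plane, u ≠ 0 ∧ ∃ r : ℝ, cross u p = r ∧ cross u d = r ∧ cross u b = r ∧
      cross u c = r := by
  by_cases hbc : c = b
  · subst hbc
    rw [segment_same, Set.mem_singleton_iff] at hm'
    subst hm'
    by_cases hpd : d = p
    · subst hpd
      rw [segment_same, Set.mem_singleton_iff] at hm
      subst hm
      exact ⟨![1, 0], fun h => by simpa using congrFun h 0, _, rfl, rfl, rfl, rfl⟩
    · have hdp : cross (d - p) d = cross (d - p) p := by simp [cross]; ring
      obtain ⟨s, t, hs, ht, hst, rfl⟩ := hm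
      have hs' : s = 1 - t := by linarith
      subst hs'
      refine ⟨d - p, sub_ne_zero.2 hpd, _, rfl, hdp, ?_, ?_⟩ <;> simp [cross] <;> ring
  · refine ⟨c - b, sub_ne_zero.2 hbc, _, hp, hd, rfl, ?_⟩
    simp [cross]; ring

namespace IsSimpleValuation

variable {z : Set Plane → ℝ}

/-- Cutting a quadrilateral, possibly degenerate, along a diagonal. -/
theorem cut_quadrilateral (hz : IsSimpleValuation z) {p d b c m : Plane}
    (hp : p ∈ Set.range latticePoint) (hd : d ∈ Set.range latticePoint)
    (hb : b ∈ Set.range latticePoint) (hc : c ∈ Set.range latticePoint)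
    (hm : m ∈ segment ℝ p d) (hm' : m ∈ segment ℝ b c) :
    z (convexHull ℝ ({p, d} ∪ {b, c})) =
      z (convexHull ℝ {p, b, c}) + z (convexHull ℝ {d, b, c}) := by
  have hS := isLatticePolytope_triangle hp hb hc
  have hT := isLatticePolytope_triangle hd hb hc
  have hST : ({p, d} ∪ {b, c} : Set Plane) = {p, b, c} ∪ {d, b, c} := by
    ext x; simp; tauto
  have hU : IsLatticePolytope (convexHull ℝ ({p, d} ∪ {b, c})) := by
    refine isLatticePolytope_convexHull (by simp) (by simp) ?_
    rintro x ((rfl | rfl) | (rfl | rfl)) <;> assumption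
  by_cases hcol : cross (c - b) p = cross (c - b) b ∧ cross (c - b) d = cross (c - b) b
  · obtain ⟨u, hu, r, h1, h2, h3, h4⟩ := exists_ne_zero_cross_eq hm hm' hcol.1 hcol.2
    rw [hz.convexHull_eq_zero (crossLin_ne_zero hu) (c := r) hU,
      hz.convexHull_eq_zero (crossLin_ne_zero hu) (c := r) hS,
      hz.convexHull_eq_zero (crossLin_ne_zero hu) (c := r) hT, add_zero]
    · rintro y (rfl | rfl | rfl) <;> assumption
    · rintro y (rfl | rfl | rfl) <;> assumption
    · rintro y ((rfl | rfl) | (rfl | rfl)) <;> assumption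
  have hbc : c - b ≠ 0 := fun h => hcol (by rw [h]; simp [cross])
  have hℓc : cross (c - b) c = cross (c - b) b := by simp [cross]; ring
  have hlin : ∀ (x y : Plane) (r s : ℝ), cross (c - b) (r • x + s • y) =
      r * cross (c - b) x + s * cross (c - b) y := fun x y r s => by simp [cross]; ring
  have hmseg : ∀ y ∈ segment ℝ b c, cross (c - b) y = cross (c - b) b := by
    rintro y ⟨r, s, -, -, hrs, rfl⟩
    rw [hlin, hℓc, ← add_mul, hrs, one_mul]
  have hml := hmseg m hm'
  have hcut : ∀ y ∈ convexHull ℝ ({p, d} ∪ {b, c}), cross (c - b) y = cross (c - b) b →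
      y ∈ segment ℝ b c := by
    intro y hy hyl
    rw [convexHull_union (by simp) (by simp), convexHull_pair, convexHull_pair,
      mem_convexJoin] at hy
    obtain ⟨y₁, hy₁, y₂, hy₂, hy⟩ := hy
    have hl₂ := hmseg y₂ hy₂
    obtain ⟨r, s, hr, hs, hrs, rfl⟩ := hy
    rw [hlin, hl₂] at hyl
    rcases eq_or_ne r 0 with rfl | hr0
    · have : s = 1 := by linarith
      subst this
      simpa using hy₂
    have hl₁ : cross (c - b) y₁ = cross (c - b) b := by
      have hs' : s = 1 - r := by linarith
      subst hs'
      apply mul_left_cancel₀ hr0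
      linarith
    -- The diagonal from `p` to `d` is not contained in the line through `b` and `c`, so it meets
    -- this line only in `m`.
    have hy₁m : y₁ = m := by
      obtain ⟨r₁, s₁, -, -, hrs₁, rfl⟩ := hy₁
      obtain ⟨r₂, s₂, -, -, hrs₂, rfl⟩ := hm
      have h1 : r₁ = 1 - s₁ := by linarith
      have h2 : r₂ = 1 - s₂ := by linarith
      subst h1 h2
      rw [hlin] at hl₁ hml
      have h3 : (s₁ - s₂) * (cross (c - b) d - cross (c - b) p) = 0 := by linarith
      rcases mul_eq_zero.1 h3 with h | h
      · rw [sub_eq_zero.1 h]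
      · exact absurd ⟨by linear_combination hl₁ - s₁ * h, by
          linear_combination hl₁ + (1 - s₁) * h⟩ hcol
    subst hy₁m
    exact (convex_segment b c) hm' hy₂ hr hs hrs
  have hsegS : ∀ x, segment ℝ b c ⊆ convexHull ℝ {x, b, c} := fun x => by
    rw [← convexHull_pair]; exact convexHull_mono (by simp)
  have hsign : (cross (c - b) b ≤ cross (c - b) p ∧ cross (c - b) d ≤ cross (c - b) b) ∨
      (cross (c - b) b ≤ cross (c - b) d ∧ cross (c - b) p ≤ cross (c - b) b) := by
    obtain ⟨r, s, hr, hs, hrs, rfl⟩ := hm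
    rw [hlin] at hml
    have hpos : ∀ x y : ℝ, 0 < x → 0 < y → 0 < r * x + s * y := by
      intro x y hx hy
      rcases hs.eq_or_lt with rfl | hs
      · have : r = 1 := by linarith
        subst this
        linarith
      · have := mul_pos hs hy
        have := mul_nonneg hr hx.le
        linarith
    by_contra hcon
    push Not at hcon
    rcases lt_trichotomy (cross (c - b) b) (cross (c - b) p) with h1 | h1 | h1
    · have h2 := hcon.1 h1.le
      have h3 : 0 < r * (cross (c - b) p - cross (c - b) b) +
          s * (cross (c - b) d - cross (c - b) b) := hpos _ _ (sub_pos.2 h1) (sub_pos.2 h2)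
      have h4 := congrArg (· * cross (c - b) b) hrs
      linarith
    · have := hcon.1 h1.le
      have := hcon.2 this.le
      linarith
    · have h2 : cross (c - b) d < cross (c - b) b := by
        by_contra h3
        linarith [hcon.2 (not_lt.1 h3)]
      have h3 : 0 < r * (cross (c - b) b - cross (c - b) p) +
          s * (cross (c - b) b - cross (c - b) d) := hpos _ _ (sub_pos.2 h1) (sub_pos.2 h2)
      have h4 := congrArg (· * cross (c - b) b) hrs
      linarith
  rcases hsign with h | h
  · rw [hST]
    refine hz.convexHull_union_eq_add (crossLin_ne_zero hbc) (c := cross (c - b) b) hS hT ?_ ?_ ?_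
    · rintro y (rfl | rfl | rfl) <;> simp [h.1, hℓc]
    · rintro y (rfl | rfl | rfl) <;> simp [h.2, hℓc]
    · rw [← hST]
      exact fun y hy hyl => ⟨hsegS _ (hcut y hy hyl), hsegS _ (hcut y hy hyl)⟩
  · rw [hST, Set.union_comm, add_comm]
    refine hz.convexHull_union_eq_add (crossLin_ne_zero hbc) (c := cross (c - b) b) hT hS ?_ ?_ ?_
    · rintro y (rfl | rfl | rfl) <;> simp [h.1, hℓc]
    · rintro y (rfl | rfl | rfl) <;> simp [h.2, hℓc]
    · rw [Set.union_comm, ← hST]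
      exact fun y hy hyl => ⟨hsegS _ (hcut y hy hyl), hsegS _ (hcut y hy hyl)⟩

/-- The two ways of cutting a quadrilateral along a diagonal. -/
theorem flip_quadrilateral (hz : IsSimpleValuation z) {p d b c m : Plane}
    (hp : p ∈ Set.range latticePoint) (hd : d ∈ Set.range latticePoint)
    (hb : b ∈ Set.range latticePoint) (hc : c ∈ Set.range latticePoint)
    (hm : m ∈ segment ℝ p d) (hm' : m ∈ segment ℝ b c) :
    z (convexHull ℝ {p, b, c}) + z (convexHull ℝ {d, b, c}) =
      z (convexHull ℝ {b, p, d}) + z (convexHull ℝ {c, p, d}) := by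
  rw [← hz.cut_quadrilateral hp hd hb hc hm hm', ← hz.cut_quadrilateral hb hc hp hd hm' hm,
    Set.union_comm]

/-- Cutting a triangle at a point of an edge. -/
theorem cut_triangle (hz : IsSimpleValuation z) {a d b m : Plane}
    (ha : a ∈ Set.range latticePoint) (hd : d ∈ Set.range latticePoint)
    (hb : b ∈ Set.range latticePoint) (hm : m ∈ Set.range latticePoint)
    (had : m ∈ segment ℝ a d) :
    z (convexHull ℝ {b, a, d}) = z (convexHull ℝ {b, a, m}) + z (convexHull ℝ {b, m, d}) := by
  -- A quadrilateral whose diagonals `a d` and `m b` meet at the vertex `m`, which is redundant in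
  -- the hull.
  have h := hz.cut_quadrilateral ha hd hm hb had (left_mem_segment ℝ m b)
  have hset : ({a, d} ∪ {m, b} : Set Plane) = insert m {b, a, d} := by ext x; simp
  have hset₁ : ({a, m, b} : Set Plane) = {b, a, m} := by ext x; simp; tauto
  have hset₂ : ({d, m, b} : Set Plane) = {b, m, d} := by ext x; simp; tauto
  rw [hset, convexHull_insert_of_mem, hset₁, hset₂] at h
  · exact h
  · rw [← convexHull_pair] at had
    exact convexHull_mono (by simp) had

/-- Subdividing a triangle at any of its lattice points. -/
theorem subdivide_triangle (hz : IsSimpleValuation z) {a b c p : Plane}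
    (ha : a ∈ Set.range latticePoint) (hb : b ∈ Set.range latticePoint)
    (hc : c ∈ Set.range latticePoint) (hp : p ∈ Set.range latticePoint)
    {α β γ : ℝ} (hα : 0 ≤ α) (hβ : 0 ≤ β) (hγ : 0 ≤ γ) (hsum : α + β + γ = 1)
    (hpe : p = α • a + β • b + γ • c) :
    z (convexHull ℝ {a, b, c}) = z (convexHull ℝ {p, b, c}) + z (convexHull ℝ {a, p, c}) +
      z (convexHull ℝ {a, b, p}) := by
  have hdeg : ∀ x y : Plane, x ∈ Set.range latticePoint → y ∈ Set.range latticePoint →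
      z (convexHull ℝ {x, x, y}) = 0 := by
    intro x y hx hy
    -- Cutting at the repeated vertex gives an identity of the form z = z + z.
    have := hz.cut_triangle hx hx hy hx (left_mem_segment ℝ x x)
    have h1 : ({y, x, x} : Set Plane) = {x, x, y} := by ext; simp; tauto
    rw [h1] at this
    linarith
  rcases eq_or_lt_of_le (show α ≤ 1 by linarith) with h1 | h1
  · have hβ0 : β = 0 := by linarith
    have hγ0 : γ = 0 := by linarith
    subst hβ0 hγ0 h1
    have : p = a := by simpa using hpe
    subst this
    have h2 : ({p, b, p} : Set Plane) = {p, p, b} := by ext; simp; tauto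
    rw [h2, hdeg p c hp hc, hdeg p b hp hb]
    ring
  have h1' : 0 < 1 - α := by linarith
  -- The ray from `a` through `p` meets the edge `b c` at parameter 1 / (1 - α). Any integer `k` at
  -- least that large gives a lattice point `d` on the ray, on or beyond the edge.
  obtain ⟨k, hk⟩ := exists_nat_ge (1 / (1 - α))
  have hk1 : 1 ≤ (k : ℝ) * (1 - α) := by rwa [div_le_iff₀ h1'] at hk
  have hkinv : 1 ≤ 1 / (1 - α) := by rw [le_div_iff₀ h1']; linarith
  have hk0 : (1 : ℝ) ≤ k := hkinv.trans hk
  have hkpos : (0 : ℝ) < k := by linarith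
  have hd : a + (k : ℝ) • (p - a) ∈ Set.range latticePoint := by
    obtain ⟨a, rfl⟩ := ha
    obtain ⟨p, rfl⟩ := hp
    exact ⟨a + (k : ℤ) • (p - a), by ext i; simp [latticePoint]⟩
  obtain ⟨d, hde⟩ : ∃ d, d = a + (k : ℝ) • (p - a) := ⟨_, rfl⟩
  rw [← hde] at hd
  have hmbc : (β / (1 - α)) • b + (γ / (1 - α)) • c ∈ segment ℝ b c :=
    ⟨_, _, by positivity, by positivity, by field_simp; linarith, rfl⟩
  obtain ⟨m, hme⟩ : ∃ m, m = (β / (1 - α)) • b + (γ / (1 - α)) • c := ⟨_, rfl⟩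
  rw [← hme] at hmbc
  have hm2 : m = a + (1 / (1 - α)) • (p - a) := by
    subst hme
    rw [hpe]
    ext i
    simp
    field_simp
    ring
  have hseg : ∀ r : ℝ, 0 ≤ r → r ≤ k → a + r • (p - a) ∈ segment ℝ a d := by
    intro r hr hrk
    refine ⟨1 - r / k, r / k, ?_, by positivity, by ring, ?_⟩
    · rw [sub_nonneg, div_le_one hkpos]; exact hrk
    · rw [hde]; ext i; simp; field_simp; ring
  have hmad : m ∈ segment ℝ a d := hm2 ▸ hseg _ (by linarith) hk
  have hpad : p ∈ segment ℝ a d := by simpa using hseg 1 zero_le_one hk0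
  have hmpd : m ∈ segment ℝ p d := by
    rcases eq_or_lt_of_le hk0 with h | h
    · have hpd : d = p := by rw [hde, ← h]; simp
      have h3 : 1 / (1 - α) = 1 := le_antisymm (h ▸ hk) hkinv
      rw [hm2, h3, hpd]
      simp
    · have h' : (0 : ℝ) < k - 1 := by linarith
      refine ⟨1 - (1 / (1 - α) - 1) / (k - 1), (1 / (1 - α) - 1) / (k - 1), ?_, ?_, by ring, ?_⟩
      · rw [sub_nonneg, div_le_one h']; linarith
      · exact div_nonneg (by linarith) h'.le
      · rw [hm2, hde]
        generalize 1 / (1 - α) = q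
        ext i
        simp
        field_simp
        ring
  -- Star subdivision is not a sequence of cuts along lattice segments inside the triangle. With the
  -- auxiliary point `d` it is a combination of two flips and two cuts in which the triangles having
  -- `d` as a vertex cancel.
  have e1 := hz.flip_quadrilateral ha hd hb hc hmad hmbc
  have e2 := hz.flip_quadrilateral hp hd hb hc hmpd hmbc
  have e3 := hz.cut_triangle ha hd hb hp hpad
  have e4 := hz.cut_triangle ha hd hc hp hpad
  have s1 : ({b, a, p} : Set Plane) = {a, b, p} := by ext; simp; tauto
  have s2 : ({c, a, p} : Set Plane) = {a, p, c} := by ext; simp; tauto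
  rw [s1] at e3
  rw [s2] at e4
  linarith

end IsSimpleValuation

/-! ### Unimodular triangulations -/

theorem image_latticeAffine_convexHull (Φ : GL (Fin 2) ℤ) (a : Fin 2 → ℤ) (S : Set Plane) :
    latticeAffine Φ a '' convexHull ℝ S = convexHull ℝ (latticeAffine Φ a '' S) := by
  let g : Plane →ᵃ[ℝ] Plane :=
    (Matrix.mulVecLin (Φ.val.map (Int.cast : ℤ → ℝ))).toAffineMap +
      AffineMap.const ℝ Plane (latticePoint a)
  have hg : ⇑g = latticeAffine Φ a := by
    ext x i
    simp [g, latticeAffine]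
  rw [← hg, g.image_convexHull]

theorem image_standardTriangle (Φ : GL (Fin 2) ℤ) (a : Fin 2 → ℤ) :
    latticeAffine Φ a '' LatticePolytope.standardTriangle.1 =
      convexHull ℝ {latticePoint a, latticePoint (a + Φ.val.col 0),
        latticePoint (a + Φ.val.col 1)} := by
  have h0 : latticeAffine Φ a ![0, 0] = latticePoint a := by
    ext i; fin_cases i <;> simp [latticeAffine, latticePoint]
  have h1 : latticeAffine Φ a ![1, 0] = latticePoint (a + Φ.val.col 0) := by
    ext i; fin_cases i <;> simp [latticeAffine, latticePoint, add_comm]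
  have h2 : latticeAffine Φ a ![0, 1] = latticePoint (a + Φ.val.col 1) := by
    ext i; fin_cases i <;> simp [latticeAffine, latticePoint, add_comm]
  rw [LatticePolytope.standardTriangle, image_latticeAffine_convexHull]
  simp only [Set.image_insert_eq, Set.image_singleton, h0, h1, h2]
  congr 1
  ext; simp; tauto

theorem latticePoint_mem_range (a : Fin 2 → ℤ) : latticePoint a ∈ Set.range latticePoint :=
  ⟨a, rfl⟩

theorem cross_latticePoint (u v : Fin 2 → ℤ) :
    cross (latticePoint u) (latticePoint v) = (cross u v : ℤ) := by
  simp [cross, latticePoint]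

theorem latticePoint_sub (u v : Fin 2 → ℤ) :
    latticePoint (u - v) = latticePoint u - latticePoint v := by
  ext i; simp [latticePoint]

theorem latticePoint_add (u v : Fin 2 → ℤ) :
    latticePoint (u + v) = latticePoint u + latticePoint v := by
  ext i; simp [latticePoint]

/-- The value at `P` of a simple valuation is a sum over unimodular triangles that do not depend
on the valuation. -/
def HasTriangulation (P : Set Plane) : Prop :=
  ∃ L : List (GL (Fin 2) ℤ × (Fin 2 → ℤ)), ∀ z : Set Plane → ℝ, IsSimpleValuation z →
    z P = (L.map fun g => z (latticeAffine g.1 g.2 '' LatticePolytope.standardTriangle.1)).sum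

theorem HasTriangulation.of_add {P Q R : Set Plane} (hP : HasTriangulation P)
    (hQ : HasTriangulation Q) (h : ∀ z, IsSimpleValuation z → z R = z P + z Q) :
    HasTriangulation R := by
  obtain ⟨L, hL⟩ := hP
  obtain ⟨M, hM⟩ := hQ
  exact ⟨L ++ M, fun z hz => by rw [h z hz, hL z hz, hM z hz]; simp⟩

theorem hasTriangulation_of_eq_zero {P : Set Plane} (h : ∀ z, IsSimpleValuation z → z P = 0) :
    HasTriangulation P :=
  ⟨[], fun z hz => by simp [h z hz]⟩

theorem hasTriangulation_of_cross_eq_one {a b c : Fin 2 → ℤ} (h : cross (b - a) (c - a) = 1) :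
    HasTriangulation (convexHull ℝ {latticePoint a, latticePoint b, latticePoint c}) := by
  let A : Matrix (Fin 2) (Fin 2) ℤ := !![(b - a) 0, (c - a) 0; (b - a) 1, (c - a) 1]
  have hA : A.det = 1 := by
    rw [det_fin_two_of, ← h, cross]
    ring
  refine ⟨[(GeneralLinearGroup.mk'' A (by simp [hA]), a)], fun z _ => ?_⟩
  have h1 : a + A.col 0 = b := by ext i; fin_cases i <;> simp [A]
  have h2 : a + A.col 1 = c := by ext i; fin_cases i <;> simp [A]
  simp only [List.map_cons, List.map_nil, List.sum_cons, List.sum_nil, add_zero,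
    image_standardTriangle]
  rw [show (GeneralLinearGroup.mk'' A (by simp [hA])).val = A from rfl, h1, h2]

/-- A lattice triangle of normalized area at least two contains a lattice point which is not a
vertex. -/
theorem exists_lattice_point_of_two_le_cross {u w : Fin 2 → ℤ} (h : 2 ≤ cross u w) :
    ∃ p : Fin 2 → ℤ, 0 ≤ cross p w ∧ cross p w < cross u w ∧ 0 ≤ cross u p ∧
      cross u p < cross u w ∧ cross p w + cross u p ≤ cross u w ∧ 0 < cross p w + cross u p := by
  -- Up to the factor `cross u w`, the numbers `cross p w` and `cross u p` are the coordinates of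
  -- `p` in the basis `u`, `w`. A vector `e` outside the sublattice spanned by `u` and `w` is
  -- reduced into the half-open parallelogram, and reflected in its centre if it falls beyond the
  -- diagonal.
  have key : ∀ e : Fin 2 → ℤ, (¬ (cross u w ∣ cross e w ∧ cross u w ∣ cross u e)) →
      ∃ p : Fin 2 → ℤ, 0 ≤ cross p w ∧ cross p w < cross u w ∧ 0 ≤ cross u p ∧
      cross u p < cross u w ∧ cross p w + cross u p ≤ cross u w ∧
      0 < cross p w + cross u p := by
    intro e he
    have hD : 0 < cross u w := by linarith
    have h1 := Int.emod_add_mul_ediv (cross e w) (cross u w)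
    have h2 := Int.emod_add_mul_ediv (cross u e) (cross u w)
    have h3 := Int.emod_nonneg (cross e w) hD.ne'
    have h4 := Int.emod_nonneg (cross u e) hD.ne'
    have h5 := Int.emod_lt_of_pos (cross e w) hD
    have h6 := Int.emod_lt_of_pos (cross u e) hD
    have h7 : 0 < cross e w % cross u w + cross u e % cross u w := by
      by_contra hcon
      exact he ⟨Int.dvd_of_emod_eq_zero (by linarith), Int.dvd_of_emod_eq_zero (by linarith)⟩
    have hgen : ∀ q r : ℤ, cross (e - q • u - r • w) w = cross e w - cross u w * q ∧
        cross u (e - q • u - r • w) = cross u e - cross u w * r := by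
      intro q r
      simp only [cross, Pi.sub_apply, Pi.smul_apply, smul_eq_mul]
      constructor <;> ring
    obtain ⟨hp1, hp2⟩ := hgen (cross e w / cross u w) (cross u e / cross u w)
    generalize e - (cross e w / cross u w) • u - (cross u e / cross u w) • w = p at hp1 hp2
    by_cases hle : cross e w % cross u w + cross u e % cross u w ≤ cross u w
    · exact ⟨p, by omega⟩
    · have hq1 : cross (u + w - p) w = cross u w - cross p w := by
        simp only [cross, Pi.sub_apply, Pi.add_apply]; ring
      have hq2 : cross u (u + w - p) = cross u w - cross u p := by
        simp only [cross, Pi.sub_apply, Pi.add_apply]; ring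
      exact ⟨u + w - p, by omega⟩
  -- The sublattice has index at least two, so it misses one of the standard basis vectors;
  -- otherwise its index would divide 1.
  by_contra hcon
  have h1 := not_not.1 fun h => hcon (key ![1, 0] h)
  have h2 := not_not.1 fun h => hcon (key ![0, 1] h)
  obtain ⟨⟨q1, hq1⟩, ⟨q2, hq2⟩⟩ := h1
  obtain ⟨⟨q3, hq3⟩, ⟨q4, hq4⟩⟩ := h2
  generalize hD : cross u w = D at *
  simp [cross] at hq1 hq2 hq3 hq4 hD
  have h3 : D * (D * (q1 * q4 - q2 * q3)) = D * 1 := by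
    linear_combination hD - D * q4 * hq1 - w 1 * hq4 + D * q3 * hq2 + (-u 1) * hq3
  have h4 : D * (q1 * q4 - q2 * q3) = 1 := mul_left_cancel₀ (by omega) h3
  have := Int.le_of_dvd one_pos (Dvd.intro _ h4)
  omega

/-- Induction on the normalized area: subdivision at a lattice point that is not a vertex gives
three triangles of strictly smaller, possibly zero, area. -/
theorem hasTriangulation_triangle (a b c : Fin 2 → ℤ) :
    HasTriangulation (convexHull ℝ {latticePoint a, latticePoint b, latticePoint c}) := by
  have key : ∀ (n : ℕ) (a b c : Fin 2 → ℤ), cross (b - a) (c - a) = n →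
      HasTriangulation (convexHull ℝ {latticePoint a, latticePoint b, latticePoint c}) := by
    intro n
    induction n using Nat.strong_induction_on with
    | _ n ih =>
    intro a b c hn
    rcases Nat.lt_or_ge n 2 with h2 | h2
    · interval_cases n
      · refine hasTriangulation_of_eq_zero fun z hz => ?_
        have hcol : cross (latticePoint b - latticePoint a) (latticePoint c - latticePoint a)
            = 0 := by
          rw [← latticePoint_sub, ← latticePoint_sub, cross_latticePoint, hn]; simp
        have hlat := isLatticePolytope_triangle (latticePoint_mem_range a)
          (latticePoint_mem_range b) (latticePoint_mem_range c)
        by_cases hab : latticePoint b - latticePoint a = 0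
        · have hab' : latticePoint b = latticePoint a := sub_eq_zero.1 hab
          rw [hab'] at hlat ⊢
          by_cases hac : latticePoint c - latticePoint a = 0
          · rw [sub_eq_zero.1 hac] at hlat ⊢
            refine hz.convexHull_eq_zero (crossLin_ne_zero (u := ![1, 0])
              fun h => by simpa using congrFun h 0) hlat
              (c := crossLin ![1, 0] (latticePoint a)) ?_
            rintro y (rfl | rfl | rfl) <;> rfl
          · refine hz.convexHull_eq_zero (crossLin_ne_zero hac) hlat
              (c := crossLin (latticePoint c - latticePoint a) (latticePoint a)) ?_
            rintro y (rfl | rfl | rfl)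
            · rfl
            · rfl
            · simp [cross]; ring
        · refine hz.convexHull_eq_zero (crossLin_ne_zero hab) hlat
              (c := crossLin (latticePoint b - latticePoint a) (latticePoint a)) ?_
          rintro y (rfl | rfl | rfl)
          · rfl
          · simp [cross]; ring
          · simp only [crossLin_apply]
            simp only [cross, Pi.sub_apply] at hcol ⊢
            linarith
      · exact hasTriangulation_of_cross_eq_one (by simpa using hn)
    · obtain ⟨p, h1, h3, h4, h5, h6, h7⟩ :=
        exists_lattice_point_of_two_le_cross (u := b - a) (w := c - a) (by omega)
      have e1 : cross (b - (p + a)) (c - (p + a)) =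
          cross (b - a) (c - a) - cross p (c - a) - cross (b - a) p := by
        simp only [cross, Pi.sub_apply, Pi.add_apply]; ring
      have t1 := ih (cross (b - (p + a)) (c - (p + a))).toNat (by omega) (p + a) b c (by omega)
      have t2 := ih (cross p (c - a)).toNat (by omega) a (p + a) c (by
        rw [add_sub_cancel_right]; omega)
      have t3 := ih (cross (b - a) p).toNat (by omega) a b (p + a) (by
        rw [add_sub_cancel_right]; omega)
      obtain ⟨L₁, hL₁⟩ := t1
      obtain ⟨L₂, hL₂⟩ := t2
      obtain ⟨L₃, hL₃⟩ := t3
      refine ⟨L₁ ++ L₂ ++ L₃, fun z hz => ?_⟩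
      have hD : (0 : ℝ) < (cross (b - a) (c - a) : ℤ) := by exact_mod_cast by omega
      -- The barycentric coordinates are ratios of areas; `p` is taken relative to `a`, hence the
      -- point `p + a`.
      have hs := hz.subdivide_triangle (latticePoint_mem_range a) (latticePoint_mem_range b)
        (latticePoint_mem_range c) (latticePoint_mem_range (p + a))
        (α := (cross (b - a) (c - a) - cross p (c - a) - cross (b - a) p : ℤ) /
          (cross (b - a) (c - a) : ℤ))
        (β := (cross p (c - a) : ℤ) / (cross (b - a) (c - a) : ℤ))
        (γ := (cross (b - a) p : ℤ) / (cross (b - a) (c - a) : ℤ))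
        (div_nonneg (by exact_mod_cast by omega) hD.le)
        (div_nonneg (by exact_mod_cast h1) hD.le)
        (div_nonneg (by exact_mod_cast h4) hD.le)
        (by field_simp; push_cast; ring)
        (by
          ext i
          simp only [Pi.add_apply, Pi.smul_apply, smul_eq_mul]
          field_simp
          fin_cases i <;> (simp [cross, latticePoint]; ring))
      rw [hs, hL₁ z hz, hL₂ z hz, hL₃ z hz]
      simp [add_assoc]
  rcases le_total 0 (cross (b - a) (c - a)) with h | h
  · exact key (cross (b - a) (c - a)).toNat a b c (by omega)
  · have h' : cross (c - a) (b - a) = - cross (b - a) (c - a) := by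
      simp only [cross, Pi.sub_apply]; ring
    have hset : ({latticePoint a, latticePoint b, latticePoint c} : Set Plane) =
        {latticePoint a, latticePoint c, latticePoint b} := by ext; simp; tauto
    rw [hset]
    exact key (cross (c - a) (b - a)).toNat a c b (by omega)

theorem IsLatticePolytope.convexHull_extremePoints {P : Set Plane} (hP : IsLatticePolytope P) :
    convexHull ℝ (P.extremePoints ℝ) = P := by
  have := closure_convexHull_extremePoints hP.isCompact hP.convex
  rwa [(hP.extremePoints_subset.2.isCompact_convexHull (𝕜 := ℝ)).isClosed.closure_eq] at this

/-- Three extreme points of a convex set are not collinear. -/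
theorem cross_ne_zero_of_mem_extremePoints {P : Set Plane} {a b c : Plane}
    (ha : a ∈ P.extremePoints ℝ) (hb : b ∈ P.extremePoints ℝ) (hc : c ∈ P.extremePoints ℝ)
    (hab : a ≠ b) (hac : a ≠ c) (hbc : b ≠ c) : cross (b - a) (c - a) ≠ 0 := by
  intro h
  rw [mem_extremePoints_iff_forall_segment] at ha hb hc
  rcases (collinear_of_cross_eq_zero h).wbtw_or_wbtw_or_wbtw with h | h | h <;>
    rw [← mem_segment_iff_wbtw] at h
  · rcases hb.2 _ ha.1 _ hc.1 h with h | h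
    · exact hab h
    · exact hbc h.symm
  · rcases hc.2 _ hb.1 _ ha.1 h with h | h
    · exact hbc h
    · exact hac h
  · rcases ha.2 _ hc.1 _ hb.1 h with h | h
    · exact hac h.symm
    · exact hab h.symm

/-- A convex set meets the line through two of its extreme points in the segment joining them. -/
theorem mem_segment_of_cross_eq_zero {P : Set Plane} {a b y : Plane}
    (ha : a ∈ P.extremePoints ℝ) (hb : b ∈ P.extremePoints ℝ) (hab : a ≠ b) (hy : y ∈ P)
    (h : cross (b - a) (y - a) = 0) : y ∈ segment ℝ a b := by
  rw [mem_extremePoints_iff_forall_segment] at ha hb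
  rcases (collinear_of_cross_eq_zero h).wbtw_or_wbtw_or_wbtw with h | h | h <;>
    rw [← mem_segment_iff_wbtw] at h
  · rcases hb.2 _ ha.1 _ hy h with h | h
    · exact absurd h hab
    · exact h ▸ right_mem_segment ℝ a y
  · rwa [segment_symm]
  · rcases ha.2 _ hy _ hb.1 h with h | h
    · exact h ▸ left_mem_segment ℝ y b
    · exact absurd h.symm hab

/-- Of four points in general position, two lie on a line that separates the other two. -/
theorem exists_separating_diagonal {a b c d : Plane} (hbc : cross (b - a) (c - a) ≠ 0)
    (hbd : cross (b - a) (d - a) ≠ 0) (hcd : cross (c - a) (d - a) ≠ 0) :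
    ∃ v p q, ((v = b ∧ p = c ∧ q = d) ∨ (v = b ∧ p = d ∧ q = c) ∨ (v = c ∧ p = b ∧ q = d) ∨
      (v = c ∧ p = d ∧ q = b) ∨ (v = d ∧ p = b ∧ q = c) ∨ (v = d ∧ p = c ∧ q = b)) ∧
      0 < cross (v - a) (p - a) ∧ cross (v - a) (q - a) < 0 := by
  have hanti : ∀ u v : Plane, cross u v = - cross v u := fun u v => by simp [cross]; ring
  have h1 := hanti (c - a) (b - a)
  have h2 := hanti (d - a) (b - a)
  have h3 := hanti (d - a) (c - a)
  rcases hbc.lt_or_gt with e1 | e1 <;> rcases hbd.lt_or_gt with e2 | e2 <;>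
    rcases hcd.lt_or_gt with e3 | e3
  · exact ⟨c, b, d, by simp, by linarith, by linarith⟩
  · exact ⟨d, b, c, by simp, by linarith, by linarith⟩
  · exact ⟨b, d, c, by simp, by linarith, by linarith⟩
  · exact ⟨b, d, c, by simp, by linarith, by linarith⟩
  · exact ⟨b, c, d, by simp, by linarith, by linarith⟩
  · exact ⟨b, c, d, by simp, by linarith, by linarith⟩
  · exact ⟨d, c, b, by simp, by linarith, by linarith⟩
  · exact ⟨c, d, b, by simp, by linarith, by linarith⟩

/-- Induction on the number of vertices. Given four vertices, the line through two of them strictly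
separates two others, so both pieces have fewer vertices. Points and segments count as triangles
with repeated vertices. -/
theorem IsLatticePolytope.hasTriangulation {P : Set Plane} (hP : IsLatticePolytope P) :
    HasTriangulation P := by
  have key : ∀ (n : ℕ) (P : Set Plane), IsLatticePolytope P → (P.extremePoints ℝ).ncard = n →
      HasTriangulation P := by
    intro n
    induction n using Nat.strong_induction_on with
    | _ n ih =>
    intro P hP hn
    have htri : ∀ a b c : Plane, P.extremePoints ℝ = {a, b, c} → HasTriangulation P := by
      intro a b c habc
      obtain ⟨a, rfl⟩ := hP.extremePoints_subset.1 (habc ▸ by simp : a ∈ P.extremePoints ℝ)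
      obtain ⟨b, rfl⟩ := hP.extremePoints_subset.1 (habc ▸ by simp : b ∈ P.extremePoints ℝ)
      obtain ⟨c, rfl⟩ := hP.extremePoints_subset.1 (habc ▸ by simp : c ∈ P.extremePoints ℝ)
      have := hasTriangulation_triangle a b c
      rwa [← habc, hP.convexHull_extremePoints] at this
    have hfin := hP.extremePoints_subset.2
    rcases Nat.lt_or_ge n 4 with h4 | h4
    · interval_cases n
      · exfalso
        rw [Set.ncard_eq_zero hfin] at hn
        have := hP.convexHull_extremePoints
        rw [hn, convexHull_empty] at this
        exact hP.nonempty.ne_empty this.symm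
      · obtain ⟨a, ha⟩ := Set.ncard_eq_one.1 hn
        exact htri a a a (by simpa using ha)
      · obtain ⟨a, b, -, hab⟩ := Set.ncard_eq_two.1 hn
        exact htri a b b (by simpa using hab)
      · obtain ⟨a, b, c, -, -, -, habc⟩ := Set.ncard_eq_three.1 hn
        exact htri a b c habc
    · obtain ⟨E, hEsub, hEcard⟩ := Set.exists_subset_card_eq (hn ▸ h4)
      obtain ⟨a, b, c, d, hab, hac, had, hbc, hbd, hcd, rfl⟩ := Set.ncard_eq_four.1 hEcard
      have ha := hEsub (by simp : a ∈ _)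
      have hb := hEsub (by simp : b ∈ _)
      have hc := hEsub (by simp : c ∈ _)
      have hd := hEsub (by simp : d ∈ _)
      obtain ⟨v, p, q, hvpq, hp, hq⟩ := exists_separating_diagonal
        (cross_ne_zero_of_mem_extremePoints ha hb hc hab hac hbc)
        (cross_ne_zero_of_mem_extremePoints ha hb hd hab had hbd)
        (cross_ne_zero_of_mem_extremePoints ha hc hd hac had hcd)
      have hmem : v ∈ P.extremePoints ℝ ∧ p ∈ P.extremePoints ℝ ∧ q ∈ P.extremePoints ℝ ∧
          a ≠ v := by
        rcases hvpq with ⟨rfl, rfl, rfl⟩ | ⟨rfl, rfl, rfl⟩ | ⟨rfl, rfl, rfl⟩ | ⟨rfl, rfl, rfl⟩ |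
          ⟨rfl, rfl, rfl⟩ | ⟨rfl, rfl, rfl⟩ <;> refine ⟨?_, ?_, ?_, ?_⟩ <;> assumption
      obtain ⟨hv, hpe, hqe, hav⟩ := hmem
      have hsub : ∀ y, cross (v - a) (y - a) = cross (v - a) y - cross (v - a) a := fun y => by
        simp [cross]; ring
      rw [hsub] at hp hq
      have hva : cross (v - a) v = cross (v - a) a := by simp [cross]; ring
      let S : Set Plane := {y ∈ P.extremePoints ℝ | cross (v - a) a ≤ cross (v - a) y}
      let T : Set Plane := {y ∈ P.extremePoints ℝ | cross (v - a) y ≤ cross (v - a) a}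
      have hST : S ∪ T = P.extremePoints ℝ := by
        ext y
        constructor
        · rintro (h | h) <;> exact h.1
        · intro h
          rcases le_total (cross (v - a) a) (cross (v - a) y) with h' | h'
          · exact Or.inl ⟨h, h'⟩
          · exact Or.inr ⟨h, h'⟩
      have haS : a ∈ S := ⟨ha, le_rfl⟩
      have haT : a ∈ T := ⟨ha, le_rfl⟩
      have hvS : v ∈ S := ⟨hv, hva.ge⟩
      have hvT : v ∈ T := ⟨hv, hva.le⟩
      have hSs : S ⊂ P.extremePoints ℝ :=
        ⟨Set.sep_subset _ _, fun h => absurd (h hqe).2 (by linarith)⟩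
      have hTs : T ⊂ P.extremePoints ℝ :=
        ⟨Set.sep_subset _ _, fun h => absurd (h hpe).2 (by linarith)⟩
      have hlat : ∀ R : Set Plane, R ⊂ P.extremePoints ℝ → a ∈ R →
          IsLatticePolytope (convexHull ℝ R) := fun R hR haR =>
        isLatticePolytope_convexHull (hfin.subset hR.1) ⟨a, haR⟩
          (hR.1.trans hP.extremePoints_subset.1)
      have hrec : ∀ R : Set Plane, R ⊂ P.extremePoints ℝ → a ∈ R →
          HasTriangulation (convexHull ℝ R) := fun R hR haR =>
        ih _ (hn ▸ (Set.ncard_le_ncard extremePoints_convexHull_subset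
          (hfin.subset hR.1)).trans_lt (Set.ncard_lt_ncard hR hfin)) _ (hlat R hR haR) rfl
      refine (hrec S hSs haS).of_add (hrec T hTs haT) fun z hz => ?_
      have hcut := hz.convexHull_union_eq_add (crossLin_ne_zero (sub_ne_zero.2 hav.symm))
        (c := cross (v - a) a) (hlat S hSs haS) (hlat T hTs haT) (fun y hy => hy.2)
        (fun y hy => hy.2) (fun y hy hyl => by
          rw [hST, hP.convexHull_extremePoints] at hy
          have hseg := mem_segment_of_cross_eq_zero ha hv hav hy
            (by rw [hsub]; exact sub_eq_zero.2 hyl)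
          exact ⟨segment_subset_convexHull haS hvS hseg, segment_subset_convexHull haT hvT hseg⟩)
      rwa [hST, hP.convexHull_extremePoints] at hcut
  exact key _ P hP rfl

/-! ### Lexicographic maxima as valuations -/

/-- `p` is the point of `P` at which `n`, and among the maximizers of `n` also `m`, is maximal. -/
def IsLexMax (n m : Plane →ₗ[ℝ] ℝ) (P : Set Plane) (p : Plane) : Prop :=
  p ∈ P ∧ ∀ q ∈ P, n q < n p ∨ (n q = n p ∧ m q ≤ m p)

/-- The lexicographically maximal point of `P` (arbitrary if there is none). -/
noncomputable def lexMax (n m : Plane →ₗ[ℝ] ℝ) (P : Set Plane) : Plane :=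
  Classical.epsilon (IsLexMax n m P)

/-- The functionals `n` and `m` separate points. -/
def Separating (n m : Plane →ₗ[ℝ] ℝ) : Prop := ∀ x y, n x = n y → m x = m y → x = y

section lexMax

variable {n m : Plane →ₗ[ℝ] ℝ} {P Q S : Set Plane} {p q : Plane}

theorem IsLexMax.unique (h : Separating n m) (hp : IsLexMax n m P p) (hq : IsLexMax n m P q) :
    p = q := by
  rcases hp.2 q hq.1 with h1 | h1
  · rcases hq.2 p hp.1 with h2 | h2
    · linarith
    · linarith [h2.1]
  · rcases hq.2 p hp.1 with h2 | h2
    · linarith [h1.1]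
    · exact h _ _ h2.1 (le_antisymm h2.2 h1.2)

theorem IsLexMax.lexMax_eq (h : Separating n m) (hp : IsLexMax n m P p) : lexMax n m P = p :=
  (Classical.epsilon_spec ⟨p, hp⟩ : IsLexMax n m P (lexMax n m P)).unique h hp

theorem isLexMax_convexHull (hp : p ∈ S) (h : ∀ q ∈ S, n q < n p ∨ (n q = n p ∧ m q ≤ m p)) :
    IsLexMax n m (convexHull ℝ S) p := by
  refine ⟨subset_convexHull ℝ S hp, fun q hq => ?_⟩
  refine convexHull_min (t := {q | n q < n p ∨ (n q = n p ∧ m q ≤ m p)}) h ?_ hq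
  intro x hx y hy a b ha hb hab
  simp only [Set.mem_ofPred_eq, map_add, map_smul, smul_eq_mul] at hx hy ⊢
  rcases ha.eq_or_lt with rfl | ha
  · have : b = 1 := by linarith
    subst this
    simpa using hy
  rcases hb.eq_or_lt with rfl | hb
  · have : a = 1 := by linarith
    subst this
    simpa using hx
  have h0 : a * n p + b * n p = n p := by rw [← add_mul, hab, one_mul]
  rcases hx with hx | hx <;> rcases hy with hy | hy
  · left; linarith [mul_lt_mul_of_pos_left hx ha, mul_lt_mul_of_pos_left hy hb]
  · left; rw [hy.1]; linarith [mul_lt_mul_of_pos_left hx ha]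
  · left; rw [hx.1]; linarith [mul_lt_mul_of_pos_left hy hb]
  · right
    rw [hx.1, hy.1]
    refine ⟨by rw [← add_mul, hab, one_mul], ?_⟩
    have h1 := mul_le_mul_of_nonneg_left hx.2 ha.le
    have h2 := mul_le_mul_of_nonneg_left hy.2 hb.le
    have h3 : a * m p + b * m p = m p := by rw [← add_mul, hab, one_mul]
    linarith

theorem exists_isLexMax_convexHull (n m : Plane →ₗ[ℝ] ℝ) (hf : S.Finite) (hS : S.Nonempty) :
    ∃ p ∈ S, IsLexMax n m (convexHull ℝ S) p := by
  obtain ⟨p, hp, hmax⟩ := hf.exists_maximalFor (fun q => toLex (n q, m q)) S hS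
  refine ⟨p, hp, isLexMax_convexHull hp fun q hq => ?_⟩
  have := (le_total (toLex (n q, m q)) (toLex (n p, m p))).elim id (hmax hq)
  simpa [Prod.Lex.toLex_le_toLex] using this

theorem IsLatticePolytope.exists_isLexMax (hP : IsLatticePolytope P) (n m : Plane →ₗ[ℝ] ℝ) :
    ∃ p, IsLexMax n m P p := by
  obtain ⟨s, hs, rfl⟩ := hP
  obtain ⟨p, -, hp⟩ := exists_isLexMax_convexHull n m (s.finite_toSet.image latticePoint)
    (hs.to_set.image _)
  exact ⟨p, hp⟩

theorem IsLatticePolytope.isLexMax_lexMax (hP : IsLatticePolytope P) (n m : Plane →ₗ[ℝ] ℝ) :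
    IsLexMax n m P (lexMax n m P) :=
  Classical.epsilon_spec (hP.exists_isLexMax n m)

/-- If the union is convex, the smaller of the two lexicographic maxima lies in both sets. -/
theorem IsLexMax.union_inter (h : Separating n m) (hP : IsClosed P) (hp : IsLexMax n m P p)
    (hq : IsLexMax n m Q q) (hc : Convex ℝ (P ∪ Q)) (hqp : n q < n p ∨ (n q = n p ∧ m q ≤ m p)) :
    IsLexMax n m (P ∪ Q) p ∧ IsLexMax n m (P ∩ Q) q := by
  refine ⟨⟨Or.inl hp.1, ?_⟩, ⟨?_, hq.1⟩, fun x hx => hq.2 x hx.2⟩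
  · rintro x (hx | hx)
    · exact hp.2 x hx
    · rcases hq.2 x hx with h1 | h1 <;> rcases hqp with h2 | h2
      · exact Or.inl (h1.trans h2)
      · exact Or.inl (h2.1 ▸ h1)
      · exact Or.inl (h1.1 ▸ h2)
      · exact Or.inr ⟨h1.1.trans h2.1, h1.2.trans h2.2⟩
  · rcases eq_or_ne q p with rfl | hne
    · exact hp.1
    -- Points of the open segment are lexicographically larger than `q`, so they cannot lie in `Q`;
    -- closedness of `P` then gives `q ∈ P`.
    have hsub : openSegment ℝ q p ⊆ P := by
      intro x hx
      rcases hc.openSegment_subset (Or.inr hq.1) (Or.inl hp.1) hx with h1 | h1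
      · exact h1
      · exfalso
        obtain ⟨a, b, ha, hb, hab, rfl⟩ := hx
        have ha' : a = 1 - b := by linarith
        have hb1 := hq.2 _ h1
        simp only [map_add, map_smul, smul_eq_mul] at hb1
        subst ha'
        rcases hqp with h2 | h2
        · rcases hb1 with h3 | h3 <;> nlinarith
        · rw [h2.1] at hb1
          rcases hb1 with h3 | h3
          · linarith
          · have h4 : m p ≤ m q := by nlinarith
            exact hne (h _ _ h2.1 (le_antisymm h2.2 h4))
    have := hP.closure_subset_iff.2 hsub
    rw [closure_openSegment] at this
    exact this (left_mem_segment ℝ q p)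

/-- Every function of the lexicographic maximum is a valuation. -/
theorem lexMax_union_add_inter (h : Separating n m) (hP : IsLatticePolytope P)
    (hQ : IsLatticePolytope Q) (hc : Convex ℝ (P ∪ Q)) (g : Plane → ℝ) :
    g (lexMax n m (P ∪ Q)) + g (lexMax n m (P ∩ Q)) = g (lexMax n m P) + g (lexMax n m Q) := by
  have hp := hP.isLexMax_lexMax n m
  have hq := hQ.isLexMax_lexMax n m
  generalize lexMax n m P = p at hp ⊢
  generalize lexMax n m Q = q at hq ⊢
  have htot : (n q < n p ∨ (n q = n p ∧ m q ≤ m p)) ∨ (n p < n q ∨ (n p = n q ∧ m p ≤ m q)) := by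
    rcases lt_trichotomy (n q) (n p) with h | h | h
    · exact Or.inl (Or.inl h)
    · rcases le_total (m q) (m p) with h' | h'
      · exact Or.inl (Or.inr ⟨h, h'⟩)
      · exact Or.inr (Or.inr ⟨h.symm, h'⟩)
    · exact Or.inr (Or.inl h)
  rcases htot with hqp | hpq
  · obtain ⟨h1, h2⟩ := hp.union_inter h hP.isClosed hq hc hqp
    rw [h1.lexMax_eq h, h2.lexMax_eq h]
  · rw [Set.union_comm] at hc
    obtain ⟨h1, h2⟩ := hq.union_inter h hQ.isClosed hp hc hpq
    rw [Set.union_comm, Set.inter_comm, h1.lexMax_eq h, h2.lexMax_eq h, add_comm]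

end lexMax

/-! ### Edges and boundary sums -/

/-- The linear functional `v ↦ ⟨u, v⟩`. -/
def dotLin (u : Plane) : Plane →ₗ[ℝ] ℝ where
  toFun v := u ⬝ᵥ v
  map_add' v w := by simp
  map_smul' r v := by simp

@[simp] theorem dotLin_apply (u v : Plane) : dotLin u v = u ⬝ᵥ v := rfl

theorem separating_cross_dot {u : Plane} (hu : u ≠ 0) (r s : ℝ) (hr : r ≠ 0) (hs : s ≠ 0) :
    Separating (r • crossLin u) (s • dotLin u) := by
  intro x y h1 h2
  simp only [LinearMap.smul_apply, crossLin_apply, dotLin_apply, smul_eq_mul, mul_eq_mul_left_iff,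
    hr, hs, or_false] at h1 h2
  simp only [cross, dotProduct, Fin.sum_univ_two] at h1 h2
  have hpos : 0 < u 0 * u 0 + u 1 * u 1 := by
    by_contra hcon
    apply hu
    have h0 : u 0 = 0 := by nlinarith [mul_self_nonneg (u 0), mul_self_nonneg (u 1)]
    have h1 : u 1 = 0 := by nlinarith [mul_self_nonneg (u 0), mul_self_nonneg (u 1)]
    ext i; fin_cases i <;> assumption
  ext i
  apply mul_left_cancel₀ hpos.ne'
  fin_cases i
  · simp only [Fin.zero_eta]
    linear_combination u 0 * h2 - u 1 * h1
  · simp only [Fin.mk_one]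
    linear_combination u 1 * h2 + u 0 * h1

/-- The last point of the edge of `P` in direction `v`, for the counterclockwise orientation of
the boundary. -/
noncomputable def edgeEnd (v : Fin 2 → ℤ) (P : Set Plane) : Plane :=
  lexMax ((-1 : ℝ) • crossLin (latticePoint v)) ((1 : ℝ) • dotLin (latticePoint v)) P

/-- The first point of the edge of `P` in direction `v`, for the counterclockwise orientation of
the boundary. -/
noncomputable def edgeStart (v : Fin 2 → ℤ) (P : Set Plane) : Plane :=
  lexMax ((-1 : ℝ) • crossLin (latticePoint v)) ((-1 : ℝ) • dotLin (latticePoint v)) P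

theorem latticePoint_ne_zero {v : Fin 2 → ℤ} (hv : v ≠ 0) : latticePoint v ≠ 0 := by
  intro h
  apply hv
  ext i
  simpa [latticePoint] using congrFun h i

theorem latticePoint_neg (v : Fin 2 → ℤ) : latticePoint (-v) = - latticePoint v := by
  ext i; simp [latticePoint]

theorem separating_edgeEnd {v : Fin 2 → ℤ} (hv : v ≠ 0) :
    Separating ((-1 : ℝ) • crossLin (latticePoint v)) ((1 : ℝ) • dotLin (latticePoint v)) :=
  separating_cross_dot (latticePoint_ne_zero hv) _ _ (by norm_num) (by norm_num)

theorem separating_edgeStart {v : Fin 2 → ℤ} (hv : v ≠ 0) :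
    Separating ((-1 : ℝ) • crossLin (latticePoint v)) ((-1 : ℝ) • dotLin (latticePoint v)) :=
  separating_cross_dot (latticePoint_ne_zero hv) _ _ (by norm_num) (by norm_num)

theorem cross_eq_zero_trans {R : Type*} [CommRing R] [NoZeroDivisors R] {u d e : Fin 2 → R}
    (hu : u ≠ 0) (hd : cross u d = 0) (he : cross u e = 0) : cross d e = 0 := by
  simp only [cross] at *
  by_cases h0 : u 0 = 0
  · have h1 : u 1 ≠ 0 := fun h1 => hu (by ext i; fin_cases i <;> assumption)
    apply (mul_eq_zero.1 (?_ : u 1 * _ = 0)).resolve_left h1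
    linear_combination d 1 * he - e 1 * hd
  · apply (mul_eq_zero.1 (?_ : u 0 * _ = 0)).resolve_left h0
    linear_combination d 0 * he - e 0 * hd

/-- By Bézout, `d` is an integer multiple of any primitive vector parallel to it, and the factor is
nonzero; so the coordinates of `v` are bounded by those of `d`. -/
theorem finite_primitive_directions (d : Fin 2 → ℤ) (hd : d ≠ 0) :
    {v : Fin 2 → ℤ | IsCoprime (v 0) (v 1) ∧ cross v d = 0}.Finite := by
  refine (Set.finite_Icc (fun i => -|d i|) (fun i => |d i|)).subset ?_
  rintro v ⟨⟨a, b, hab⟩, hvd⟩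
  simp only [cross] at hvd
  have h0 : d 0 = v 0 * (a * d 0 + b * d 1) := by linear_combination (-d 0) * hab - b * hvd
  have h1 : d 1 = v 1 * (a * d 0 + b * d 1) := by linear_combination (-d 1) * hab + a * hvd
  have hk : 1 ≤ |a * d 0 + b * d 1| := by
    refine Int.one_le_abs fun hk => hd ?_
    rw [hk, mul_zero] at h0 h1
    ext i
    fin_cases i <;> assumption
  have hle : ∀ i, |v i| ≤ |d i| := by
    intro i
    have : |d i| = |v i| * |a * d 0 + b * d 1| := by
      rw [← abs_mul]
      fin_cases i
      · exact congrArg abs h0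
      · exact congrArg abs h1
    rw [this]
    exact le_mul_of_one_le_right (abs_nonneg _) hk
  exact ⟨fun i => (abs_le.1 (hle i)).1, fun i => (abs_le.1 (hle i)).2⟩

theorem IsLexMax.left_eq {n m m' : Plane →ₗ[ℝ] ℝ} {P : Set Plane} {p q : Plane}
    (hp : IsLexMax n m P p) (hq : IsLexMax n m' P q) : n p = n q := by
  rcases hp.2 q hq.1 with h1 | h1
  · rcases hq.2 p hp.1 with h2 | h2
    · linarith
    · exact h2.1
  · exact h1.1.symm

/-- The contribution to a boundary sum of the edge in direction `v`. -/
noncomputable def edgeTerm (ψ : (Fin 2 → ℤ) → Plane → ℝ) (P : Set Plane) (v : Fin 2 → ℤ) : ℝ :=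
  ψ v (edgeEnd v P) - ψ v (edgeStart v P)

/-- The sum over the edges of `P`, oriented counterclockwise, of the increments of `ψ`. -/
noncomputable def boundarySum (ψ : (Fin 2 → ℤ) → Plane → ℝ) (P : Set Plane) : ℝ :=
  ∑ᶠ v, edgeTerm ψ P v

section boundarySum

variable {ψ : (Fin 2 → ℤ) → Plane → ℝ} {P Q : Set Plane}

theorem ne_zero_of_isCoprime {v : Fin 2 → ℤ} (hv : IsCoprime (v 0) (v 1)) : v ≠ 0 := by
  rintro rfl
  simp [isCoprime_zero_left] at hv

/-- A nonzero term needs distinct edge ends, so its direction is parallel to a difference of two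
generating points; each difference admits finitely many primitive directions. -/
theorem edgeTerm_support_finite (hψ : ∀ v, ¬ IsCoprime (v 0) (v 1) → ψ v = 0)
    (hP : IsLatticePolytope P) : (Function.support (edgeTerm ψ P)).Finite := by
  obtain ⟨s, hs, rfl⟩ := hP
  have hfin : (⋃ a ∈ (s : Set (Fin 2 → ℤ)), ⋃ b ∈ (s : Set (Fin 2 → ℤ)), if a = b then ∅ else
      {v : Fin 2 → ℤ | IsCoprime (v 0) (v 1) ∧ cross v (a - b) = 0}).Finite := by
    refine s.finite_toSet.biUnion fun a _ => s.finite_toSet.biUnion fun b _ => ?_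
    split_ifs with h
    · exact Set.finite_empty
    · exact finite_primitive_directions _ (sub_ne_zero.2 h)
  refine hfin.subset fun v hv => ?_
  have hc : IsCoprime (v 0) (v 1) := by
    by_contra hc
    exact hv (by simp [edgeTerm, hψ v hc])
  have hv0 := ne_zero_of_isCoprime hc
  have hfs := s.finite_toSet.image latticePoint
  obtain ⟨_, ⟨a, ha, rfl⟩, hae⟩ := exists_isLexMax_convexHull
    ((-1 : ℝ) • crossLin (latticePoint v)) ((1 : ℝ) • dotLin (latticePoint v)) hfs
      (hs.to_set.image _)
  obtain ⟨_, ⟨b, hb, rfl⟩, hbe⟩ := exists_isLexMax_convexHull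
    ((-1 : ℝ) • crossLin (latticePoint v)) ((-1 : ℝ) • dotLin (latticePoint v)) hfs
      (hs.to_set.image _)
  have hab : a ≠ b := by
    rintro rfl
    refine hv ?_
    rw [edgeTerm, edgeEnd, edgeStart, hae.lexMax_eq (separating_edgeEnd hv0),
      hbe.lexMax_eq (separating_edgeStart hv0), sub_self]
  simp only [Set.mem_iUnion]
  refine ⟨a, ha, b, hb, ?_⟩
  rw [if_neg hab]
  refine ⟨hc, ?_⟩
  have h3 := hae.left_eq hbe
  simp only [LinearMap.smul_apply, crossLin_apply, smul_eq_mul, neg_one_mul, neg_inj] at h3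
  rw [cross_latticePoint, cross_latticePoint, Int.cast_inj] at h3
  simp only [cross, Pi.sub_apply] at h3 ⊢
  linarith

/-- If `P` is parallel to `v`, reversing `v` exchanges the two ends. Otherwise start and end
coincide for both directions and both terms vanish. -/
theorem edgeTerm_neg (hneg : ∀ v, ψ (-v) = ψ v) (hP : IsLatticePolytope P)
    (hdim : Module.finrank ℝ (vectorSpan ℝ P) ≤ 1) {v : Fin 2 → ℤ} (hv : v ≠ 0) :
    edgeTerm ψ P (-v) = - edgeTerm ψ P v := by
  have h3 := separating_edgeEnd (neg_ne_zero.2 hv)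
  have h4 := separating_edgeStart (neg_ne_zero.2 hv)
  have m1 := hP.isLexMax_lexMax ((-1 : ℝ) • crossLin (latticePoint v))
    ((1 : ℝ) • dotLin (latticePoint v))
  have m2 := hP.isLexMax_lexMax ((-1 : ℝ) • crossLin (latticePoint v))
    ((-1 : ℝ) • dotLin (latticePoint v))
  rw [← edgeEnd] at m1
  rw [← edgeStart] at m2
  by_cases hconst : ∀ a ∈ P, ∀ b ∈ P,
      cross (latticePoint v) a = cross (latticePoint v) b
  · have e1 : edgeStart (-v) P = edgeEnd v P := by
      refine IsLexMax.lexMax_eq h4 ⟨m1.1, fun q hq => Or.inr ⟨?_, ?_⟩⟩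
      · have := hconst q hq _ m1.1
        simp [latticePoint_neg, cross] at this ⊢
        linarith
      · have := m1.2 q hq
        simp [hconst q hq _ m1.1] at this
        simpa [latticePoint_neg] using this
    have e2 : edgeEnd (-v) P = edgeStart v P := by
      refine IsLexMax.lexMax_eq h3 ⟨m2.1, fun q hq => Or.inr ⟨?_, ?_⟩⟩
      · have := hconst q hq _ m2.1
        simp [latticePoint_neg, cross] at this ⊢
        linarith
      · have := m2.2 q hq
        simp [hconst q hq _ m2.1] at this
        simpa [latticePoint_neg] using this
    rw [edgeTerm, edgeTerm, e1, e2, hneg]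
    ring
  · push Not at hconst
    obtain ⟨a, ha, b, hb, hab⟩ := hconst
    obtain ⟨u, hu, hu'⟩ := exists_functional_of_finrank_le_one hdim
    have key : ∀ w : Fin 2 → ℤ, w ≠ 0 → (w = v ∨ w = -v) → edgeStart w P = edgeEnd w P := by
      intro w hw hwv
      have m1 := hP.isLexMax_lexMax ((-1 : ℝ) • crossLin (latticePoint w))
        ((1 : ℝ) • dotLin (latticePoint w))
      have m2 := hP.isLexMax_lexMax ((-1 : ℝ) • crossLin (latticePoint w))
        ((-1 : ℝ) • dotLin (latticePoint w))
      rw [← edgeEnd] at m1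
      rw [← edgeStart] at m2
      have h8 := m1.left_eq m2
      simp only [LinearMap.smul_apply, crossLin_apply, smul_eq_mul, neg_one_mul, neg_inj] at h8
      have h4 : cross (latticePoint v) (edgeStart w P - edgeEnd w P) = 0 := by
        rcases hwv with rfl | rfl
        · simp only [cross, Pi.sub_apply] at h8 ⊢
          linarith
        · simp only [cross, Pi.sub_apply, latticePoint_neg, Pi.neg_apply] at h8 ⊢
          linarith
      by_contra hne
      have h5 := cross_eq_zero_trans hu (hu' _ m1.1 _ m2.1) (hu' _ hb _ ha)
      have h6 : cross (edgeStart w P - edgeEnd w P) (latticePoint v) = 0 := by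
        simp only [cross] at h4 ⊢; linarith
      have h7 := cross_eq_zero_trans (sub_ne_zero.2 hne) h6 h5
      apply hab
      simp only [cross, Pi.sub_apply] at h7 ⊢
      linarith
    rw [edgeTerm, edgeTerm, key v hv (Or.inl rfl), key (-v) (neg_ne_zero.2 hv) (Or.inr rfl)]
    simp

/-- The valuation property holds term by term, because edge ends are lexicographic maxima. On a
degenerate polygon the reindexing v ↦ -v turns the sum into its negative. -/
theorem isSimpleValuation_boundarySum (hψ : ∀ v, ¬ IsCoprime (v 0) (v 1) → ψ v = 0)
    (hneg : ∀ v, ψ (-v) = ψ v) : IsSimpleValuation (boundarySum ψ) := by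
  refine ⟨fun P Q hP hQ hc => ?_, fun P hP hdim => ?_⟩
  · have hU := hP.union hQ hc
    have hI := hP.inter hQ hc
    rw [boundarySum, boundarySum, boundarySum, boundarySum,
      ← finsum_add_distrib (edgeTerm_support_finite hψ hU) (edgeTerm_support_finite hψ hI),
      ← finsum_add_distrib (edgeTerm_support_finite hψ hP) (edgeTerm_support_finite hψ hQ)]
    refine finsum_congr fun v => ?_
    by_cases hv : IsCoprime (v 0) (v 1)
    · have hv0 := ne_zero_of_isCoprime hv
      have h1 := lexMax_union_add_inter (separating_edgeEnd hv0) hP hQ hc (ψ v)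
      have h2 := lexMax_union_add_inter (separating_edgeStart hv0) hP hQ hc (ψ v)
      simp only [edgeTerm, edgeEnd, edgeStart]
      linarith
    · simp [edgeTerm, hψ v hv]
  · have h : boundarySum ψ P = - boundarySum ψ P := by
      conv_lhs => rw [boundarySum, ← finsum_comp_equiv (Equiv.neg (Fin 2 → ℤ))]
      rw [boundarySum, ← finsum_neg_distrib]
      refine finsum_congr fun v => ?_
      by_cases hv : v = 0
      · subst hv
        have h0 : ψ 0 = 0 := hψ 0 (by simp [isCoprime_zero_left])
        simp [edgeTerm, h0]
      · exact edgeTerm_neg hneg hP hdim hv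
    linarith

end boundarySum

/-! ### The boundary sum of a unimodular triangle -/

section triangle

variable {ψ : (Fin 2 → ℤ) → Plane → ℝ} {v : Fin 2 → ℤ} {s : Set (Fin 2 → ℤ)} {p : Fin 2 → ℤ}

theorem dot_latticePoint (u v : Fin 2 → ℤ) :
    latticePoint u ⬝ᵥ latticePoint v = (u ⬝ᵥ v : ℤ) := by
  simp [latticePoint, dotProduct]

theorem edgeEnd_convexHull (hv : v ≠ 0) (hp : p ∈ s)
    (h : ∀ q ∈ s, cross v p < cross v q ∨ (cross v p = cross v q ∧ v ⬝ᵥ q ≤ v ⬝ᵥ p)) :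
    edgeEnd v (convexHull ℝ (latticePoint '' s)) = latticePoint p := by
  refine (isLexMax_convexHull (Set.mem_image_of_mem _ hp) ?_).lexMax_eq (separating_edgeEnd hv)
  rintro _ ⟨q, hq, rfl⟩
  simp only [LinearMap.smul_apply, crossLin_apply, dotLin_apply, smul_eq_mul, neg_one_mul,
    neg_lt_neg_iff, neg_inj, one_mul, cross_latticePoint, dot_latticePoint, Int.cast_lt,
    Int.cast_inj, Int.cast_le]
  exact (h q hq).imp id fun h => ⟨h.1.symm, h.2⟩

theorem edgeStart_convexHull (hv : v ≠ 0) (hp : p ∈ s)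
    (h : ∀ q ∈ s, cross v p < cross v q ∨ (cross v p = cross v q ∧ v ⬝ᵥ p ≤ v ⬝ᵥ q)) :
    edgeStart v (convexHull ℝ (latticePoint '' s)) = latticePoint p := by
  refine (isLexMax_convexHull (Set.mem_image_of_mem _ hp) ?_).lexMax_eq (separating_edgeStart hv)
  rintro _ ⟨q, hq, rfl⟩
  simp only [LinearMap.smul_apply, crossLin_apply, dotLin_apply, smul_eq_mul, neg_one_mul,
    neg_lt_neg_iff, neg_le_neg_iff, neg_inj, cross_latticePoint, dot_latticePoint, Int.cast_lt,
    Int.cast_inj, Int.cast_le]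
  exact (h q hq).imp id fun h => ⟨h.1.symm, h.2⟩

theorem exists_edgeEnd_convexHull (hv : v ≠ 0) (hf : s.Finite) (hs : s.Nonempty) :
    ∃ p ∈ s, edgeEnd v (convexHull ℝ (latticePoint '' s)) = latticePoint p ∧
      ∀ q ∈ s, cross v p < cross v q ∨ (cross v p = cross v q ∧ v ⬝ᵥ q ≤ v ⬝ᵥ p) := by
  obtain ⟨p, hp, hmax⟩ := hf.exists_maximalFor (fun q => toLex (- cross v q, v ⬝ᵥ q)) s hs
  have h : ∀ q ∈ s, cross v p < cross v q ∨ (cross v p = cross v q ∧ v ⬝ᵥ q ≤ v ⬝ᵥ p) := by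
    intro q hq
    have := (le_total (toLex (- cross v q, v ⬝ᵥ q)) (toLex (- cross v p, v ⬝ᵥ p))).elim id (hmax hq)
    simpa [Prod.Lex.toLex_le_toLex, eq_comm] using this
  exact ⟨p, hp, edgeEnd_convexHull hv hp h, h⟩

theorem exists_edgeStart_convexHull (hv : v ≠ 0) (hf : s.Finite) (hs : s.Nonempty) :
    ∃ p ∈ s, edgeStart v (convexHull ℝ (latticePoint '' s)) = latticePoint p ∧
      ∀ q ∈ s, cross v p < cross v q ∨ (cross v p = cross v q ∧ v ⬝ᵥ p ≤ v ⬝ᵥ q) := by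
  obtain ⟨p, hp, hmax⟩ := hf.exists_maximalFor (fun q => toLex (- cross v q, - (v ⬝ᵥ q))) s hs
  have h : ∀ q ∈ s, cross v p < cross v q ∨ (cross v p = cross v q ∧ v ⬝ᵥ p ≤ v ⬝ᵥ q) := by
    intro q hq
    have := (le_total (toLex (- cross v q, - (v ⬝ᵥ q)))
      (toLex (- cross v p, - (v ⬝ᵥ p)))).elim id (hmax hq)
    simpa only [Prod.Lex.toLex_le_toLex, neg_lt_neg_iff, neg_inj, neg_le_neg_iff,
      @eq_comm _ (cross v q)] using this
  exact ⟨p, hp, edgeStart_convexHull hv hp h, h⟩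

theorem isCoprime_of_cross_eq_one {u w : Fin 2 → ℤ} (h : cross u w = 1) :
    IsCoprime (u 0) (u 1) := ⟨w 1, - w 0, by rw [← h, cross]; ring⟩

/-- Both vectors are primitive and parallel: `d` is `k` times `v`, where `k` divides `cross d e = 1`
and is positive. -/
theorem eq_of_cross_eq_zero {d e : Fin 2 → ℤ} (hv : IsCoprime (v 0) (v 1)) (hd : cross d e = 1)
    (h : cross v d = 0) (hpos : 0 < v ⬝ᵥ d) : v = d := by
  obtain ⟨a, b, hab⟩ := hv
  have hk : ∀ i, d i = (a * d 0 + b * d 1) * v i := by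
    simp only [cross] at h
    intro i
    fin_cases i
    · simp only [Fin.zero_eta]; linear_combination (-d 0) * hab - b * h
    · simp only [Fin.mk_one]; linear_combination (-d 1) * hab + a * h
  generalize a * d 0 + b * d 1 = k at hk
  have hk1 : k * cross v e = 1 := by
    rw [← hd]; simp only [cross]; linear_combination (-e 1) * hk 0 + e 0 * hk 1
  have hk0 : 0 < k := by
    simp only [dotProduct, Fin.sum_univ_two, hk] at hpos
    by_contra hk0
    nlinarith [mul_self_nonneg (v 0), mul_self_nonneg (v 1)]
  have hk1 : k = 1 := by
    rcases Int.eq_one_or_neg_one_of_mul_eq_one hk1 with h | h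
    · exact h
    · omega
  ext i
  rw [hk i, hk1, one_mul]

theorem edge_triangle {p q r : Fin 2 → ℤ} (h : cross (q - p) (r - p) = 1) :
    edgeTerm ψ (convexHull ℝ (latticePoint '' {p, q, r})) (q - p) =
      ψ (q - p) (latticePoint q) - ψ (q - p) (latticePoint p) := by
  have hv : q - p ≠ 0 := ne_zero_of_isCoprime (isCoprime_of_cross_eq_one h)
  have h1 : cross (q - p) r = cross (q - p) p + 1 := by
    rw [← h]; simp only [cross, Pi.sub_apply]; ring
  have h2 : cross (q - p) q = cross (q - p) p := by
    simp only [cross, Pi.sub_apply]; ring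
  have h3 : (q - p) ⬝ᵥ p ≤ (q - p) ⬝ᵥ q := by
    simp only [dotProduct, Fin.sum_univ_two, Pi.sub_apply]
    nlinarith [mul_self_nonneg (q 0 - p 0), mul_self_nonneg (q 1 - p 1)]
  rw [edgeTerm, edgeEnd_convexHull hv (p := q) (by simp),
    edgeStart_convexHull hv (p := p) (by simp)]
  · rintro x (rfl | rfl | rfl)
    · simp
    · exact Or.inr ⟨h2.symm, h3⟩
    · left; omega
  · rintro x (rfl | rfl | rfl)
    · exact Or.inr ⟨h2, h3⟩
    · simp
    · left; omega

/-- The boundary sum of a positively oriented unimodular triangle. -/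
theorem boundarySum_triangle (hψ : ∀ v, ¬ IsCoprime (v 0) (v 1) → ψ v = 0)
    {a b c : Fin 2 → ℤ} (h : cross (b - a) (c - a) = 1) :
    boundarySum ψ (convexHull ℝ {latticePoint a, latticePoint b, latticePoint c}) =
      (ψ (b - a) (latticePoint b) - ψ (b - a) (latticePoint a)) +
      (ψ (c - b) (latticePoint c) - ψ (c - b) (latticePoint b)) +
      (ψ (a - c) (latticePoint a) - ψ (a - c) (latticePoint c)) := by
  have hset : ({latticePoint a, latticePoint b, latticePoint c} : Set Plane) =
      latticePoint '' {a, b, c} := by simp [Set.image_insert_eq]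
  have hbca : cross (c - b) (a - b) = 1 := by
    rw [← h]; simp only [cross, Pi.sub_apply]; ring
  have hcab : cross (a - c) (b - c) = 1 := by
    rw [← h]; simp only [cross, Pi.sub_apply]; ring
  have e1 := edge_triangle (ψ := ψ) h
  have e2 := edge_triangle (ψ := ψ) hbca
  have e3 := edge_triangle (ψ := ψ) hcab
  rw [show ({b, c, a} : Set (Fin 2 → ℤ)) = {a, b, c} by ext; simp; tauto] at e2
  rw [show ({c, a, b} : Set (Fin 2 → ℤ)) = {a, b, c} by ext; simp; tauto] at e3
  rw [hset, ← e1, ← e2, ← e3, boundarySum]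
  -- A direction running against an edge has the third vertex strictly on its right, so `cross v` is
  -- not minimal on that edge.
  have hbad : ∀ {p q r v : Fin 2 → ℤ}, cross (q - p) (r - p) = 1 → IsCoprime (v 0) (v 1) →
      cross v p = cross v q → v ⬝ᵥ q < v ⬝ᵥ p → v = p - q ∧ cross v r < cross v p := by
    intro p q r v h hv h1 h2
    have hvd : v = p - q := by
      refine eq_of_cross_eq_zero (e := q - r) hv ?_ ?_ ?_
      · rw [← h]; simp only [cross, Pi.sub_apply]; ring
      · simp only [cross, Pi.sub_apply] at h1 ⊢; linarith
      · rw [dotProduct_sub]; linarith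
    refine ⟨hvd, ?_⟩
    rw [hvd]
    simp only [cross, Pi.sub_apply] at h ⊢
    linarith
  have hgood : ∀ {p q r v : Fin 2 → ℤ}, cross (q - p) (r - p) = 1 → IsCoprime (v 0) (v 1) →
      cross v p = cross v q → v ⬝ᵥ p < v ⬝ᵥ q → v = q - p := by
    intro p q r v h hv h1 h2
    refine eq_of_cross_eq_zero hv h ?_ ?_
    · simp only [cross, Pi.sub_apply] at h1 ⊢; linarith
    · rw [dotProduct_sub]; linarith
  rw [finsum_eq_sum_of_support_subset (s := {b - a, c - b, a - c})]
  · have n1 : b - a ≠ c - b := fun hn => by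
      rw [hn, show c - a = (c - b) + (b - a) by abel, hn] at h
      simp [cross] at h; ring_nf at h; simp at h
    have n2 : b - a ≠ a - c := fun hn => by
      rw [hn] at h; simp [cross] at h; ring_nf at h; simp at h
    have n3 : c - b ≠ a - c := fun hn => by
      rw [hn, show a - b = (a - c) + (c - b) by abel, hn] at hbca
      simp [cross] at hbca; ring_nf at hbca; simp at hbca
    rw [Finset.sum_insert (by simp [n1, n2]), Finset.sum_insert (by simp [n3]),
      Finset.sum_singleton, add_assoc]
  · intro v hv
    have hc : IsCoprime (v 0) (v 1) := by
      by_contra hc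
      exact hv (by simp [edgeTerm, hψ v hc])
    have hv0 := ne_zero_of_isCoprime hc
    obtain ⟨p, hp, hpe, hpm⟩ := exists_edgeEnd_convexHull hv0 (s := {a, b, c}) (by simp) (by simp)
    obtain ⟨q, hq, hqe, hqm⟩ := exists_edgeStart_convexHull hv0 (s := {a, b, c}) (by simp) (by simp)
    have hpq : p ≠ q := by
      rintro rfl
      exact hv (by rw [edgeTerm, hpe, hqe, sub_self])
    have h1 := hpm q hq
    have h2 := hqm p hp
    have h3 : cross v p = cross v q := by omega
    have h4 : v ⬝ᵥ q < v ⬝ᵥ p := by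
      refine lt_of_le_of_ne (by omega) fun h4 => hpq ?_
      have := separating_edgeEnd hv0 (latticePoint p) (latticePoint q)
        (by simp [cross_latticePoint, h3])
        (by rw [LinearMap.smul_apply, LinearMap.smul_apply, dotLin_apply, dotLin_apply,
          dot_latticePoint, dot_latticePoint, h4])
      rw [← sub_eq_zero] at this ⊢
      by_contra hne
      exact latticePoint_ne_zero hne (by rw [latticePoint_sub, this])
    have ha := hpm a (by simp)
    have hb := hpm b (by simp)
    have hcc := hpm c (by simp)
    simp only [Finset.coe_insert, Finset.coe_singleton, Set.mem_insert_iff, Set.mem_singleton_iff]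
    rcases hp with rfl | rfl | rfl <;> rcases hq with rfl | rfl | rfl
    · exact absurd rfl hpq
    · have := hbad h hc h3 h4
      omega
    · exact Or.inr (Or.inr (hgood hcab hc h3.symm h4))
    · exact Or.inl (hgood h hc h3.symm h4)
    · exact absurd rfl hpq
    · have := hbad hbca hc h3 h4
      omega
    · have := hbad hcab hc h3 h4
      omega
    · exact Or.inr (Or.inl (hgood hbca hc h3.symm h4))
    · exact absurd rfl hpq

end triangle

/-! ### Edge values in a cone by the Euclidean algorithm -/

/-- The functional equations satisfied by the value of a simple covariant valuation at the
standard triangle. -/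
structure IsTriangleFun (F : ℝ → ℝ → ℝ) : Prop where
  rot : ∀ x y, F (-x + y) (-x) = Real.exp (-x) * F x y
  square : ∀ x y, F x y + Real.exp (x + y) * F (-x) (-y) = F x (x + y) + F (x + y) y
  symm : ∀ x y, F x y = F y x

/-- Compatibility of the edge values `A` and `B` of the two edges of a unimodular parallelogram
with the value of the parallelogram. -/
def SquareCompatible (F : ℝ → ℝ → ℝ) (α β A B : ℝ) : Prop :=
  A * (1 - Real.exp β) - B * (1 - Real.exp α) = F α β + Real.exp (α + β) * F (-α) (-β)

/-- The edge value of the diagonal of a unimodular parallelogram. -/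
noncomputable def diagonalValue (F : ℝ → ℝ → ℝ) (α β A B : ℝ) : ℝ :=
  A + Real.exp α * B - F α (α + β)

/-- The edge value of the primitive vector `p • u + q • w`, computed by the subtractive Euclidean
algorithm from the edge values `A` and `B` of the basis `u`, `w`. -/
noncomputable def coneValue (F : ℝ → ℝ → ℝ) : ℕ → ℕ → ℝ → ℝ → ℝ → ℝ → ℝ
  | 0, _, _, _, _, B => B
  | _ + 1, 0, _, _, A, _ => A
  | p + 1, q + 1, α, β, A, B =>
    if q ≤ p then coneValue F (p - q) (q + 1) α (α + β) A (diagonalValue F α β A B)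
    else coneValue F (p + 1) (q - p) (α + β) β (diagonalValue F α β A B) B
termination_by p q => p + q

section cone

variable {F : ℝ → ℝ → ℝ} {α β A B : ℝ}

theorem coneValue_zero_left (q : ℕ) : coneValue F 0 q α β A B = B := by
  rw [coneValue]

theorem coneValue_zero_right {p : ℕ} (hp : 0 < p) : coneValue F p 0 α β A B = A := by
  obtain ⟨p, rfl⟩ := Nat.exists_eq_succ_of_ne_zero hp.ne'
  rw [coneValue]

theorem coneValue_add_left {p q : ℕ} (h : 0 < p + q) :
    coneValue F (p + q) q α β A B =
      coneValue F p q α (α + β) A (diagonalValue F α β A B) := by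
  rcases q with _ | q
  · rw [add_zero] at h
    rw [add_zero, coneValue_zero_right h, coneValue_zero_right h]
  · rw [← add_assoc, coneValue, if_pos (by omega), Nat.add_sub_cancel]

theorem coneValue_add_right {p q : ℕ} (h : 0 < p + q) :
    coneValue F p (q + p) α β A B =
      coneValue F p q (α + β) β (diagonalValue F α β A B) B := by
  rcases p with _ | p
  · rw [coneValue_zero_left, coneValue_zero_left]
  · rcases q with _ | q
    -- For equal coefficients the definition takes the other branch, but both branches end at
    -- `diagonalValue`.
    · have h1 := coneValue_add_left (F := F) (p := 0) (q := p + 1) (α := α) (β := β) (A := A)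
        (B := B) (by omega)
      rw [zero_add, coneValue_zero_left] at h1
      rw [zero_add, h1, coneValue_zero_right (by omega)]
    · rw [show q + 1 + (p + 1) = (q + p + 1) + 1 by omega, coneValue, if_neg (by omega),
        show q + p + 1 - p = q + 1 by omega]

/-- Passes from the basis u, w to u, u + w. By the square equation the old parallelogram is the sum
of the triangles o, u, u+w and o, u+w, w; by `rot` the new one arises by translating the second
triangle by u. -/
theorem SquareCompatible.left (hF : IsTriangleFun F) (h : SquareCompatible F α β A B) :
    SquareCompatible F α (α + β) A (diagonalValue F α β A B) := by
  have h1 := hF.rot (α + β) β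
  have h2 := hF.square α β
  have h3 : Real.exp (α + (α + β)) * Real.exp (-(α + β)) = Real.exp α := by
    rw [← Real.exp_add]; congr 1; ring
  rw [show -(α + β) + β = -α by ring] at h1
  simp only [SquareCompatible, diagonalValue] at h ⊢
  rw [h1, ← mul_assoc, h3]
  rw [Real.exp_add] at h h2 ⊢
  linear_combination Real.exp α * h + Real.exp α * h2

/-- The analogous shear to the basis u + w, w, where the triangle o, u, u+w is translated by w. -/
theorem SquareCompatible.right (hF : IsTriangleFun F) (h : SquareCompatible F α β A B) :
    SquareCompatible F (α + β) β (diagonalValue F α β A B) B := by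
  have h4 := hF.square α β
  have h1 := hF.rot (α + β) α
  have h3 : Real.exp (α + β + β) * Real.exp (-(α + β)) = Real.exp β := by
    rw [← Real.exp_add]; congr 1; ring
  rw [show -(α + β) + α = -β by ring, hF.symm (-β), hF.symm (α + β) α] at h1
  simp only [SquareCompatible, diagonalValue] at h ⊢
  rw [h1, ← mul_assoc, h3]
  rw [Real.exp_add] at h h4 ⊢
  linear_combination h + h4

/-- The edge values in a cone spanned by a basis are compatible with the values of all positively
oriented unimodular triangles spanned by vectors in the cone. -/
theorem coneValue_spec (hF : IsTriangleFun F) (h : SquareCompatible F α β A B) {a b c d : ℕ}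
    (hdet : a * d = b * c + 1) :
    (coneValue F a b α β A B + Real.exp (a * α + b * β) * coneValue F c d α β A B -
      coneValue F (a + c) (b + d) α β A B =
        F (a * α + b * β) (a * α + b * β + (c * α + d * β))) ∧
    SquareCompatible F (a * α + b * β) (c * α + d * β) (coneValue F a b α β A B)
      (coneValue F c d α β A B) := by
  have key : ∀ (n : ℕ) (a b c d : ℕ) (α β A B : ℝ), a + b + c + d = n → a * d = b * c + 1 →
      SquareCompatible F α β A B →
      (coneValue F a b α β A B + Real.exp (a * α + b * β) * coneValue F c d α β A B -
        coneValue F (a + c) (b + d) α β A B =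
          F (a * α + b * β) (a * α + b * β + (c * α + d * β))) ∧
      SquareCompatible F (a * α + b * β) (c * α + d * β) (coneValue F a b α β A B)
        (coneValue F c d α β A B) := by
    intro n
    induction n using Nat.strong_induction_on with
    | _ n ih =>
    intro a b c d α β A B hn hdet h
    have ha : 0 < a := Nat.pos_of_ne_zero (by rintro rfl; omega)
    have hd : 0 < d := Nat.pos_of_ne_zero (by rintro rfl; omega)
    -- Stern–Brocot descent: if both vectors lie in the same half of the cone, that half is taken as
    -- the new cone. A pair of determinant one in neither half is the basis itself.
    by_cases h1 : b ≤ a ∧ d ≤ c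
    · obtain ⟨a, rfl⟩ := Nat.exists_eq_add_of_le' h1.1
      obtain ⟨c, rfl⟩ := Nat.exists_eq_add_of_le' h1.2
      have := ih (a + b + c + d) (by omega) a b c d α (α + β) A (diagonalValue F α β A B) rfl
        (by nlinarith) (h.left hF)
      rw [coneValue_add_left ha, coneValue_add_left (by omega),
        show a + b + (c + d) = (a + c) + (b + d) by ring, coneValue_add_left (by omega)]
      have e : ∀ p q : ℕ, ((p + q : ℕ) : ℝ) * α + q * β = p * α + q * (α + β) := fun p q => by
        push_cast; ring
      rwa [e, e]
    by_cases h2 : a ≤ b ∧ c ≤ d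
    · obtain ⟨b, rfl⟩ := Nat.exists_eq_add_of_le' h2.1
      obtain ⟨d, rfl⟩ := Nat.exists_eq_add_of_le' h2.2
      have := ih (a + b + c + d) (by omega) a b c d (α + β) β (diagonalValue F α β A B) B rfl
        (by nlinarith) (h.right hF)
      rw [coneValue_add_right (by omega), coneValue_add_right (by omega),
        show b + a + (d + c) = (b + d) + (a + c) by ring, coneValue_add_right (by omega)]
      have e : ∀ p q : ℕ, (p : ℝ) * α + ((q + p : ℕ) : ℝ) * β = p * (α + β) + q * β := fun p q => by
        push_cast; ring
      rwa [e, e]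
    have h3 : b < a ∧ c < d := by
      by_contra h3
      have h4 : a < b ∧ d < c := by omega
      nlinarith
    have hb : b = 0 := by nlinarith
    have hc : c = 0 := by nlinarith
    subst hb hc
    have ha1 : a = 1 := Nat.eq_one_of_mul_eq_one_right (by simpa using hdet)
    subst ha1
    have hd1 : d = 1 := by omega
    subst hd1
    have h5 := coneValue_add_left (F := F) (p := 0) (q := 1) (α := α) (β := β) (A := A) (B := B)
      (by omega)
    rw [zero_add, coneValue_zero_left] at h5
    rw [coneValue_zero_left, coneValue_zero_right one_pos]
    simp only [add_zero, zero_add, h5]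
    refine ⟨?_, by simpa using h⟩
    simp [diagonalValue]
  exact key _ a b c d α β A B rfl hdet h

end cone

/-! ### Edge values on all primitive vectors -/

/-- Both vectors lie in the first closed quadrant, or both lie in the second one. -/
def SameQuadrant (a b : Fin 2 → ℤ) : Prop :=
  (0 ≤ a 0 ∧ 0 ≤ a 1 ∧ 0 ≤ b 0 ∧ 0 ≤ b 1) ∨ (a 0 ≤ 0 ∧ 0 ≤ a 1 ∧ b 0 ≤ 0 ∧ 0 ≤ b 1)

/-- Unless the two vectors are the standard basis, one dominates the other coordinatewise. This
locates `a + b` when `a` and `b` lie in opposite quadrants. -/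
theorem compare_of_det_eq_one {p q r s : ℤ} (hp : 0 ≤ p) (hq : 0 ≤ q) (hr : 0 ≤ r) (hs : 0 ≤ s)
    (h : p * s - q * r = 1) :
    (r ≤ p ∧ s ≤ q) ∨ (p ≤ r ∧ q ≤ s) ∨ (p = 1 ∧ q = 0 ∧ r = 0 ∧ s = 1) := by
  by_contra hcon
  have h3 : q < s ∧ r < p := by
    by_contra h3
    have h4 : p < r ∧ s < q := by omega
    nlinarith
  have hq0 : q = 0 := by nlinarith
  have hr0 : r = 0 := by nlinarith
  subst hq0 hr0
  have : p = 1 := by nlinarith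
  subst this
  omega

/-- Up to a common sign, two consecutive ones of the vectors `a`, `b`, `-(a + b)` lie in the same
quadrant. -/
def HasSameQuadrantPair (a b : Fin 2 → ℤ) : Prop :=
  SameQuadrant a b ∨ SameQuadrant (-a) (-b) ∨ SameQuadrant b (-(a + b)) ∨
    SameQuadrant (-b) (a + b) ∨ SameQuadrant (-(a + b)) a ∨ SameQuadrant (a + b) (-a)

theorem HasSameQuadrantPair.rotate {a b : Fin 2 → ℤ} (h : HasSameQuadrantPair b (-(a + b))) :
    HasSameQuadrantPair a b := by
  have e2 : b + -(a + b) = -a := by abel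
  simp only [HasSameQuadrantPair, e2, neg_neg] at h ⊢
  tauto

/-- When `a` and `b` are in opposite quadrants, `a + b` is a difference of two vectors of one
quadrant, hence shares a quadrant with `b` or with `a` up to sign. In the exceptional case of
`compare_of_det_eq_one`, `a` and `b` lie on the axes and share a quadrant of the other kind. -/
theorem hasSameQuadrantPair_of_first {a b : Fin 2 → ℤ} (h : cross a b = 1)
    (ha : (0 ≤ a 0 ∧ 0 ≤ a 1) ∨ (a 0 ≤ 0 ∧ a 1 ≤ 0))
    (hb : (0 ≤ b 0 ∧ 0 ≤ b 1) ∨ (b 0 ≤ 0 ∧ b 1 ≤ 0)) : HasSameQuadrantPair a b := by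
  simp only [cross] at h
  simp only [HasSameQuadrantPair, SameQuadrant, Pi.neg_apply, Pi.add_apply]
  rcases ha with ⟨ha0, ha1⟩ | ⟨ha0, ha1⟩ <;> rcases hb with ⟨hb0, hb1⟩ | ⟨hb0, hb1⟩
  · exact Or.inl (Or.inl (by omega))
  · rcases compare_of_det_eq_one (p := -b 0) (q := -b 1) (r := a 0) (s := a 1)
      (by omega) (by omega) ha0 ha1 (by linarith) with h | h | h
    · exact Or.inr (Or.inr (Or.inr (Or.inr (Or.inl (Or.inl (by omega))))))
    · exact Or.inr (Or.inr (Or.inr (Or.inl (Or.inl (by omega)))))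
    · exact Or.inl (Or.inr (by omega))
  · rcases compare_of_det_eq_one (p := b 0) (q := b 1) (r := -a 0) (s := -a 1)
      hb0 hb1 (by omega) (by omega) (by linarith) with h | h | h
    · exact Or.inr (Or.inr (Or.inr (Or.inr (Or.inr (Or.inl (by omega))))))
    · exact Or.inr (Or.inr (Or.inl (Or.inl (by omega))))
    · exact Or.inr (Or.inl (Or.inr (by omega)))
  · exact Or.inr (Or.inl (Or.inl (by omega)))

theorem hasSameQuadrantPair_of_second {a b : Fin 2 → ℤ} (h : cross a b = 1)
    (ha : (a 0 ≤ 0 ∧ 0 ≤ a 1) ∨ (0 ≤ a 0 ∧ a 1 ≤ 0))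
    (hb : (b 0 ≤ 0 ∧ 0 ≤ b 1) ∨ (0 ≤ b 0 ∧ b 1 ≤ 0)) : HasSameQuadrantPair a b := by
  simp only [cross] at h
  simp only [HasSameQuadrantPair, SameQuadrant, Pi.neg_apply, Pi.add_apply]
  rcases ha with ⟨ha0, ha1⟩ | ⟨ha0, ha1⟩ <;> rcases hb with ⟨hb0, hb1⟩ | ⟨hb0, hb1⟩
  · exact Or.inl (Or.inr (by omega))
  · rcases compare_of_det_eq_one (p := -b 1) (q := b 0) (r := a 1) (s := -a 0)
      (by omega) (by omega) (by omega) (by omega) (by linarith) with h | h | h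
    · exact Or.inr (Or.inr (Or.inr (Or.inr (Or.inl (Or.inr (by omega))))))
    · exact Or.inr (Or.inr (Or.inr (Or.inl (Or.inr (by omega)))))
    · exact Or.inr (Or.inl (Or.inl (by omega)))
  · rcases compare_of_det_eq_one (p := b 1) (q := -b 0) (r := -a 1) (s := a 0)
      (by omega) (by omega) (by omega) (by omega) (by linarith) with h | h | h
    · exact Or.inr (Or.inr (Or.inr (Or.inr (Or.inr (Or.inr (by omega))))))
    · exact Or.inr (Or.inr (Or.inl (Or.inr (by omega))))
    · exact Or.inl (Or.inl (by omega))
  · exact Or.inr (Or.inl (Or.inr (by omega)))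

/-- Pigeonhole: two of the three edge vectors `a`, `b`, `-(a + b)` lie in the same of the two unions
of opposite quadrants. -/
theorem hasSameQuadrantPair_of_cross_eq_one {a b : Fin 2 → ℤ} (h : cross a b = 1) :
    HasSameQuadrantPair a b := by
  have hq : ∀ v : Fin 2 → ℤ, ((0 ≤ v 0 ∧ 0 ≤ v 1) ∨ (v 0 ≤ 0 ∧ v 1 ≤ 0)) ∨
      ((v 0 ≤ 0 ∧ 0 ≤ v 1) ∨ (0 ≤ v 0 ∧ v 1 ≤ 0)) := by intro v; omega
  have c1 : cross b (-(a + b)) = 1 := by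
    rw [← h]; simp only [cross, Pi.neg_apply, Pi.add_apply]; ring
  have c2 : cross (-(a + b)) (-(b + -(a + b))) = 1 := by
    rw [← h]; simp only [cross, Pi.neg_apply, Pi.add_apply]; ring
  have e : -(b + -(a + b)) = a := by abel
  rcases hq a with ha | ha <;> rcases hq b with hb | hb
  · exact hasSameQuadrantPair_of_first h ha hb
  · rcases hq (-(a + b)) with hc | hc
    · exact ((hasSameQuadrantPair_of_first c2 hc (by rwa [e])).rotate :
        HasSameQuadrantPair b _).rotate
    · exact (hasSameQuadrantPair_of_second c1 hb hc).rotate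
  · rcases hq (-(a + b)) with hc | hc
    · exact (hasSameQuadrantPair_of_first c1 hb hc).rotate
    · exact ((hasSameQuadrantPair_of_second c2 hc (by rwa [e])).rotate :
        HasSameQuadrantPair b _).rotate
  · exact hasSameQuadrantPair_of_second h ha hb

/-- Edge values on all primitive vectors, extended from the upper half plane by the symmetry
`v ↦ -v`. -/
noncomputable def edgeValue (F : ℝ → ℝ → ℝ) (α β A B : ℝ) (v : Fin 2 → ℤ) : ℝ :=
  if 0 < v 1 ∨ (v 1 = 0 ∧ 0 < v 0) then
    if 0 ≤ v 0 then coneValue F (v 0).toNat (v 1).toNat α β A B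
    else coneValue F (v 1).toNat (-v 0).toNat β (-α) B (-Real.exp (-α) * A)
  else
    -Real.exp (v 0 * α + v 1 * β) *
      if v 0 ≤ 0 then coneValue F (-v 0).toNat (-v 1).toNat α β A B
      else coneValue F (-v 1).toNat (v 0).toNat β (-α) B (-Real.exp (-α) * A)

section edgeValue

variable {F : ℝ → ℝ → ℝ} {α β A B : ℝ}

theorem edgeValue_neg {v : Fin 2 → ℤ} (hv : v ≠ 0) :
    edgeValue F α β A B (-v) = -Real.exp (-(v 0 * α + v 1 * β)) * edgeValue F α β A B v := by
  have hv' : v 0 ≠ 0 ∨ v 1 ≠ 0 := by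
    by_contra h
    push Not at h
    exact hv (by ext i; fin_cases i; exacts [h.1, h.2])
  by_cases hup : 0 < v 1 ∨ (v 1 = 0 ∧ 0 < v 0)
  · rw [edgeValue, edgeValue, if_pos hup, if_neg (by simp only [Pi.neg_apply]; omega)]
    simp only [Pi.neg_apply, neg_neg, Left.neg_nonpos_iff, Int.cast_neg]
    congr 3
    ring
  · rw [edgeValue, edgeValue, if_neg hup, if_pos (by simp only [Pi.neg_apply]; omega)]
    simp only [Pi.neg_apply, neg_neg, Left.nonneg_neg_iff]
    rw [← mul_assoc, neg_mul_neg, ← Real.exp_add, neg_add_cancel, Real.exp_zero, one_mul]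

theorem edgeValue_first_quadrant (p q : ℕ) (h : 0 < p + q) {v : Fin 2 → ℤ} (h0 : v 0 = p)
    (h1 : v 1 = q) : edgeValue F α β A B v = coneValue F p q α β A B := by
  rw [edgeValue, if_pos (by omega), if_pos (by omega), h0, h1]
  simp

/-- On the negative first axis `coneValue` ignores the multiple and returns the value of -e₁, whence
`q = 1` if `p = 0`. -/
theorem edgeValue_second_quadrant (p q : ℕ) (h : 0 < p ∨ q = 1) {v : Fin 2 → ℤ}
    (h0 : v 0 = -q) (h1 : v 1 = p) :
    edgeValue F α β A B v = coneValue F p q β (-α) B (-Real.exp (-α) * A) := by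
  rcases Nat.eq_zero_or_pos p with rfl | hp
  · have hq : q = 1 := by omega
    subst hq
    rw [edgeValue, if_neg (by omega), if_pos (by omega), h0, h1, coneValue_zero_left]
    simp [coneValue_zero_right]
  · rcases Nat.eq_zero_or_pos q with rfl | hq
    · rw [edgeValue_first_quadrant 0 p (by omega) (by simpa using h0) h1, coneValue_zero_left,
        coneValue_zero_right hp]
    · rw [edgeValue, if_pos (by omega), if_neg (by omega), h0, h1]
      simp

/-- The parallelogram on w, -u is that on u, w translated by -u, but halved by the other diagonal;
the square equation equates the two halvings. -/
theorem SquareCompatible.rotate (hF : IsTriangleFun F) (h : SquareCompatible F α β A B) :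
    SquareCompatible F β (-α) B (-Real.exp (-α) * A) := by
  have h1 := hF.rot α (α + β)
  have h2 := hF.rot (-α) (-(α + β))
  have h3 := hF.rot (α + β) β
  have h4 := hF.square α β
  have hX : Real.exp (-α) * Real.exp α = 1 := by rw [← Real.exp_add, neg_add_cancel, Real.exp_zero]
  have hY : Real.exp (-β) * Real.exp β = 1 := by rw [← Real.exp_add, neg_add_cancel, Real.exp_zero]
  rw [show -α + (α + β) = β by ring] at h1
  rw [show - -α + -(α + β) = -β by ring, neg_neg] at h2
  rw [show -(α + β) + β = -α by ring] at h3
  simp only [SquareCompatible, neg_neg] at h ⊢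
  rw [h1, h2, h3, neg_add, Real.exp_add, Real.exp_add]
  rw [Real.exp_add] at h h4
  generalize Real.exp α = X at *
  generalize Real.exp β = Y at *
  generalize Real.exp (-α) = p at *
  generalize Real.exp (-β) = q at *
  linear_combination p * h + p * h4 - B * hX - p * F (α + β) β * (hX * (q * Y) + hY)

/-- The triangle equation for the image of a triangle under `x ↦ -x`. -/
theorem triangle_equation_neg (hF : IsTriangleFun F) {C : ℝ}
    (h1 : A + Real.exp α * B - C = F α (α + β)) (h2 : SquareCompatible F α β A B) :
    -Real.exp (-α) * A + Real.exp (-α) * (-Real.exp (-β) * B) - (-Real.exp (-(α + β)) * C) =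
      F (-α) (-α + -β) := by
  have h3 := hF.rot (α + β) β
  have h4 := hF.square α β
  have hY : Real.exp (-β) * Real.exp β = 1 := by rw [← Real.exp_add, neg_add_cancel, Real.exp_zero]
  rw [show -(α + β) + β = -α by ring] at h3
  simp only [SquareCompatible] at h2
  rw [← neg_add, h3, neg_add, Real.exp_add]
  rw [Real.exp_add] at h2 h4
  linear_combination Real.exp (-α) * Real.exp (-β) * (h2 + h4 - h1) + A * Real.exp (-α) * hY

/-- The triangle equation with another vertex as base point. -/
theorem triangle_equation_rotate (hF : IsTriangleFun F) {C : ℝ}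
    (h1 : A + Real.exp α * B - C = F α (α + β)) :
    B + Real.exp β * (-Real.exp (-(α + β)) * C) - (-Real.exp (-α) * A) =
      F β (β + -(α + β)) := by
  have h3 := hF.rot α (α + β)
  have hX : Real.exp (-α) * Real.exp α = 1 := by rw [← Real.exp_add, neg_add_cancel, Real.exp_zero]
  have hY : Real.exp (-β) * Real.exp β = 1 := by rw [← Real.exp_add, neg_add_cancel, Real.exp_zero]
  rw [show -α + (α + β) = β by ring] at h3
  rw [show β + -(α + β) = -α by ring, h3, neg_add, Real.exp_add]
  linear_combination Real.exp (-α) * h1 - B * hX - Real.exp (-α) * C * hY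

/-- Compatibility of edge values with the values of positively oriented unimodular triangles. -/
theorem edgeValue_spec (hF : IsTriangleFun F) (h : SquareCompatible F α β A B)
    {a b : Fin 2 → ℤ} (hab : cross a b = 1) :
    edgeValue F α β A B a + Real.exp (a 0 * α + a 1 * β) * edgeValue F α β A B b -
      edgeValue F α β A B (a + b) =
        F (a 0 * α + a 1 * β) (a 0 * α + a 1 * β + (b 0 * α + b 1 * β)) := by
  have good : ∀ a b : Fin 2 → ℤ, cross a b = 1 → SameQuadrant a b →
      (edgeValue F α β A B a + Real.exp (a 0 * α + a 1 * β) * edgeValue F α β A B b -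
        edgeValue F α β A B (a + b) =
          F (a 0 * α + a 1 * β) (a 0 * α + a 1 * β + (b 0 * α + b 1 * β))) ∧
      SquareCompatible F (a 0 * α + a 1 * β) (b 0 * α + b 1 * β) (edgeValue F α β A B a)
        (edgeValue F α β A B b) := by
    rintro a b hab (⟨ha0, ha1, hb0, hb1⟩ | ⟨ha0, ha1, hb0, hb1⟩)
    · obtain ⟨p, hp⟩ := Int.eq_ofNat_of_zero_le ha0
      obtain ⟨q, hq⟩ := Int.eq_ofNat_of_zero_le ha1
      obtain ⟨r, hr⟩ := Int.eq_ofNat_of_zero_le hb0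
      obtain ⟨s, hs⟩ := Int.eq_ofNat_of_zero_le hb1
      have hdet : p * s = q * r + 1 := by
        simp only [cross, hp, hq, hr, hs] at hab
        zify; linarith
      have hp0 : 0 < p := Nat.pos_of_ne_zero (by rintro rfl; omega)
      have hs0 : 0 < s := Nat.pos_of_ne_zero (by rintro rfl; omega)
      have := coneValue_spec hF h hdet
      rw [edgeValue_first_quadrant p q (by omega) hp hq,
        edgeValue_first_quadrant r s (by omega) hr hs,
        edgeValue_first_quadrant (p + r) (q + s) (by omega) (by simp [hp, hr]) (by simp [hq, hs])]
      simpa [hp, hq, hr, hs] using this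
    · obtain ⟨q, hq⟩ := Int.eq_ofNat_of_zero_le (neg_nonneg.2 ha0)
      obtain ⟨p, hp⟩ := Int.eq_ofNat_of_zero_le ha1
      obtain ⟨s, hs⟩ := Int.eq_ofNat_of_zero_le (neg_nonneg.2 hb0)
      obtain ⟨r, hr⟩ := Int.eq_ofNat_of_zero_le hb1
      have hq : a 0 = -q := by omega
      have hs : b 0 = -s := by omega
      have hdet : p * s = q * r + 1 := by
        simp only [cross, hp, hq, hr, hs] at hab
        zify; linarith
      have hp0 : 0 < p := Nat.pos_of_ne_zero (by rintro rfl; omega)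
      have hs0 : 0 < s := Nat.pos_of_ne_zero (by rintro rfl; omega)
      have hrs : 0 < r ∨ s = 1 := by
        rcases Nat.eq_zero_or_pos r with rfl | hr
        · right
          exact Nat.eq_one_of_mul_eq_one_left (by simpa using hdet)
        · exact Or.inl hr
      have := coneValue_spec hF (h.rotate hF) hdet
      rw [edgeValue_second_quadrant p q (by omega) hq hp,
        edgeValue_second_quadrant r s hrs hs hr,
        edgeValue_second_quadrant (p + r) (q + s) (by omega) (by simp [hq, hs]; ring)
          (by simp [hp, hr])]
      have e : ∀ x y : ℕ, ((-(x : ℤ) : ℤ) : ℝ) * α + ((y : ℤ) : ℝ) * β = y * β + x * (-α) := by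
        intro x y; push_cast; ring
      rw [hp, hq, hr, hs, e, e]
      exact this
  have hne : ∀ a b : Fin 2 → ℤ, cross a b = 1 → a ≠ 0 ∧ b ≠ 0 ∧ a + b ≠ 0 := by
    intro a b hab
    refine ⟨?_, ?_, ?_⟩
    · rintro rfl; simp [cross] at hab
    · rintro rfl; simp [cross] at hab
    · intro h0
      rw [eq_neg_of_add_eq_zero_left h0] at hab
      simp [cross] at hab
      ring_nf at hab
      simp at hab
  have hadd : ∀ a b : Fin 2 → ℤ, ((a + b) 0 : ℤ) * α + ((a + b) 1 : ℤ) * β =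
      (a 0 * α + a 1 * β) + (b 0 * α + b 1 * β) := by
    intro a b; simp only [Pi.add_apply]; push_cast; ring
  have hneg : ∀ a : Fin 2 → ℤ, ((-a) 0 : ℤ) * α + ((-a) 1 : ℤ) * β = -(a 0 * α + a 1 * β) := by
    intro a; simp only [Pi.neg_apply]; push_cast; ring
  have neg : ∀ a b : Fin 2 → ℤ, cross a b = 1 → SameQuadrant (-a) (-b) →
      edgeValue F α β A B a + Real.exp (a 0 * α + a 1 * β) * edgeValue F α β A B b -
        edgeValue F α β A B (a + b) =
          F (a 0 * α + a 1 * β) (a 0 * α + a 1 * β + (b 0 * α + b 1 * β)) := by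
    intro a b hab hq
    obtain ⟨a, rfl⟩ : ∃ c, a = -c := ⟨-a, (neg_neg a).symm⟩
    obtain ⟨b, rfl⟩ : ∃ c, b = -c := ⟨-b, (neg_neg b).symm⟩
    rw [neg_neg, neg_neg] at hq
    have hab' : cross a b = 1 := by rw [← hab]; simp [cross]
    obtain ⟨g1, g2⟩ := good a b hab' hq
    obtain ⟨ha, hb, hs⟩ := hne a b hab'
    rw [← neg_add, edgeValue_neg ha, edgeValue_neg hb, edgeValue_neg hs, hneg, hneg, hadd]
    -- A triangle and its reflection form a parallelogram up to translation, so its compatibility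
    -- `g2` is needed besides the equation `g1`.
    exact triangle_equation_neg hF g1 g2
  have rot : ∀ a b : Fin 2 → ℤ, cross a b = 1 →
      edgeValue F α β A B a + Real.exp (a 0 * α + a 1 * β) * edgeValue F α β A B b -
        edgeValue F α β A B (a + b) =
          F (a 0 * α + a 1 * β) (a 0 * α + a 1 * β + (b 0 * α + b 1 * β)) →
      edgeValue F α β A B b + Real.exp (b 0 * α + b 1 * β) * edgeValue F α β A B (-(a + b)) -
        edgeValue F α β A B (b + -(a + b)) =
          F (b 0 * α + b 1 * β) (b 0 * α + b 1 * β +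
            ((-(a + b)) 0 * α + (-(a + b)) 1 * β)) := by
    intro a b hab h
    obtain ⟨ha, -, hs⟩ := hne a b hab
    rw [show b + -(a + b) = -a by abel, edgeValue_neg ha, edgeValue_neg hs, hadd]
    have e := hneg (a + b)
    rw [hadd] at e
    rw [e]
    exact triangle_equation_rotate hF h
  have c1 : cross b (-(a + b)) = 1 := by
    rw [← hab]; simp only [cross, Pi.neg_apply, Pi.add_apply]; ring
  have c2 : cross (-(a + b)) a = 1 := by
    rw [← hab]; simp only [cross, Pi.neg_apply, Pi.add_apply]; ring
  have r1 := rot _ _ c1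
  have r2 := rot _ _ c2
  rw [show -(b + -(a + b)) = a by abel] at r1
  rw [show -(-(a + b) + a) = b by abel] at r2
  -- The equation passes from one base vertex of the triangle to the next, so a single pair of
  -- consecutive edges in a common quadrant, up to sign, is enough.
  rcases hasSameQuadrantPair_of_cross_eq_one hab with h | h | h | h | h | h
  · exact (good _ _ hab h).1
  · exact neg _ _ hab h
  · exact r2 (r1 (good _ _ c1 h).1)
  · exact r2 (r1 (neg _ _ c1 (by rwa [neg_neg])))
  · exact r2 (good _ _ c2 h).1
  · exact r2 (neg _ _ c2 (by rwa [neg_neg]))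

end edgeValue

/-! ### The valuation at a point other than the origin -/

section pointwise

variable {f : Plane → ℝ}

theorem affineAct_eq (Φ : GL (Fin 2) ℤ) (a : Fin 2 → ℤ) (f : Plane → ℝ) (x : Plane) :
    affineAct Φ a f x = Real.exp (latticePoint a ⬝ᵥ x) *
      f ![latticePoint (Φ.val.col 0) ⬝ᵥ x, latticePoint (Φ.val.col 1) ⬝ᵥ x] := by
  rw [affineAct]
  congr 2
  ext i
  fin_cases i <;> simp [mulVec, dotProduct, latticePoint]

/-- The increments of `edgePotential x v` along `v` are proportional to the exponential function. -/
noncomputable def edgePotential (x : Plane) (v : Fin 2 → ℤ) (p : Plane) : ℝ :=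
  if latticePoint v ⬝ᵥ x = 0 then
    Real.exp (p ⬝ᵥ x) * (latticePoint v ⬝ᵥ p / latticePoint v ⬝ᵥ latticePoint v)
  else Real.exp (p ⬝ᵥ x) / (Real.exp (latticePoint v ⬝ᵥ x) - 1)

/-- Along an edge these increments telescope to a geometric sum over its lattice points. For ⟨v, x⟩
= 0 the ratio is 1, and a linear factor replaces the quotient. -/
theorem edgePotential_add {x : Plane} {v : Fin 2 → ℤ} (hv : v ≠ 0) (p : Plane) :
    edgePotential x v (p + latticePoint v) - edgePotential x v p = Real.exp (p ⬝ᵥ x) := by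
  unfold edgePotential
  split_ifs with h
  · have h0 : latticePoint v ⬝ᵥ latticePoint v ≠ 0 := fun h =>
      latticePoint_ne_zero hv (dotProduct_self_eq_zero.1 h)
    rw [add_dotProduct, h, add_zero, dotProduct_add, add_div, div_self h0]
    ring
  · have h0 : Real.exp (latticePoint v ⬝ᵥ x) - 1 ≠ 0 := by
      rwa [sub_ne_zero, Ne, Real.exp_eq_one_iff]
    rw [add_dotProduct, Real.exp_add]
    field_simp

/-- The factor is inverse to that of `edgeValue_neg`, which makes the product of edge value and
potential even in `v`. -/
theorem edgePotential_neg (x : Plane) (v : Fin 2 → ℤ) (p : Plane) :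
    -Real.exp (-(latticePoint v ⬝ᵥ x)) * edgePotential x (-v) p = edgePotential x v p := by
  unfold edgePotential
  simp only [latticePoint_neg, neg_dotProduct, dotProduct_neg, neg_eq_zero, neg_neg]
  split_ifs with h
  · rw [h, neg_zero, Real.exp_zero]
    ring
  · have h0 : Real.exp (latticePoint v ⬝ᵥ x) - 1 ≠ 0 := by
      rwa [sub_ne_zero, Ne, Real.exp_eq_one_iff]
    have h1 : Real.exp (-(latticePoint v ⬝ᵥ x)) - 1 ≠ 0 := by
      rwa [sub_ne_zero, Ne, Real.exp_eq_one_iff, neg_eq_zero]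
    have h2 : Real.exp (-(latticePoint v ⬝ᵥ x)) * Real.exp (latticePoint v ⬝ᵥ x) = 1 := by
      rw [← Real.exp_add, neg_add_cancel, Real.exp_zero]
    rw [← mul_div_assoc, div_eq_div_iff h1 h0]
    linear_combination (-Real.exp (p ⬝ᵥ x)) * h2

/-- The coefficients of the linear equation vanish together only for α = β = 0; this is why the
origin is treated separately. -/
theorem exists_squareCompatible (F : ℝ → ℝ → ℝ) {α β : ℝ} (h : α ≠ 0 ∨ β ≠ 0) :
    ∃ A B, SquareCompatible F α β A B := by
  have hexp : ∀ t : ℝ, t ≠ 0 → 1 - Real.exp t ≠ 0 := fun t ht => by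
    rwa [sub_ne_zero, ne_comm, Ne, Real.exp_eq_one_iff]
  by_cases hβ : β = 0
  · have := hexp α (h.resolve_right (not_not.2 hβ))
    exact ⟨0, -(F α β + Real.exp (α + β) * F (-α) (-β)) / (1 - Real.exp α), by
      rw [SquareCompatible]; field_simp; ring⟩
  · have := hexp β hβ
    exact ⟨(F α β + Real.exp (α + β) * F (-α) (-β)) / (1 - Real.exp β), 0, by
      rw [SquareCompatible]; field_simp; ring⟩

theorem latticePoint_dot (v : Fin 2 → ℤ) (x : Plane) :
    latticePoint v ⬝ᵥ x = v 0 * x 0 + v 1 * x 1 := by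
  simp [latticePoint, dotProduct]

theorem cross_col (Φ : GL (Fin 2) ℤ) : cross (Φ.val.col 0) (Φ.val.col 1) = Φ.val.det := by
  rw [det_fin_two, cross]; simp; ring

theorem det_eq_one_or_neg_one (Φ : GL (Fin 2) ℤ) : Φ.val.det = 1 ∨ Φ.val.det = -1 :=
  Int.isUnit_iff.1 ((isUnit_iff_isUnit_det _).1 Φ.isUnit)

open Classical in
theorem exists_simpleValuation_of_ne_zero (hf : IsTriangleFun fun s t => f ![s, t]) {x : Plane}
    (hx : x ≠ 0) : ∃ z : Set Plane → ℝ, IsSimpleValuation z ∧ ∀ (Φ : GL (Fin 2) ℤ) (a : Fin 2 → ℤ),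
      z (latticeAffine Φ a '' LatticePolytope.standardTriangle.1) = affineAct Φ a f x := by
  have hx' : x 0 ≠ 0 ∨ x 1 ≠ 0 := by
    by_contra h
    push Not at h
    exact hx (by ext i; fin_cases i; exacts [h.1, h.2])
  obtain ⟨A, B, hAB⟩ := exists_squareCompatible (fun s t => f ![s, t]) hx'
  let e := edgeValue (fun s t => f ![s, t]) (x 0) (x 1) A B
  let ψ : (Fin 2 → ℤ) → Plane → ℝ := fun v =>
    if IsCoprime (v 0) (v 1) then fun p => e v * edgePotential x v p else 0
  have hψ : ∀ v, ¬ IsCoprime (v 0) (v 1) → ψ v = 0 := fun v hv => if_neg hv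
  have hneg : ∀ v, ψ (-v) = ψ v := by
    intro v
    by_cases hv : IsCoprime (v 0) (v 1)
    · have hv' : IsCoprime ((-v) 0) ((-v) 1) := hv.neg_neg
      funext p
      simp only [ψ, if_pos hv, if_pos hv', e]
      rw [edgeValue_neg (ne_zero_of_isCoprime hv), ← edgePotential_neg x v, latticePoint_dot]
      ring
    · have hv' : ¬ IsCoprime ((-v) 0) ((-v) 1) := by simpa [IsCoprime.neg_neg_iff] using hv
      rw [hψ v hv, hψ _ hv']
  have hinc : ∀ {a b c : Fin 2 → ℤ}, cross (b - a) c = 1 →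
      ψ (b - a) (latticePoint b) - ψ (b - a) (latticePoint a) =
        Real.exp (latticePoint a ⬝ᵥ x) * e (b - a) := by
    intro a b c h
    have hc := isCoprime_of_cross_eq_one h
    simp only [ψ, if_pos hc]
    rw [← mul_sub, ← edgePotential_add (ne_zero_of_isCoprime hc), ← latticePoint_add,
      add_sub_cancel, mul_comm]
  have htri : ∀ {a u w : Fin 2 → ℤ}, cross u w = 1 →
      boundarySum ψ (convexHull ℝ {latticePoint a, latticePoint (a + u), latticePoint (a + w)}) =
        Real.exp (latticePoint a ⬝ᵥ x) * f ![latticePoint u ⬝ᵥ x, latticePoint w ⬝ᵥ x] := by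
    intro a u w h
    rw [boundarySum_triangle hψ (by simpa using h),
      hinc (c := w) (by simpa using h),
      hinc (c := -u)
        (by rw [← h]; simp only [cross, Pi.sub_apply, Pi.add_apply, Pi.neg_apply]; ring),
      hinc (c := u) (by rw [← h]; simp only [cross, Pi.sub_apply, Pi.add_apply]; ring)]
    -- The closing edge runs from `a + w` along `-w`; by antisymmetry it contributes minus the value
    -- of `w` based at `a`.
    have hs := edgeValue_spec hf hAB (a := u) (b := w - u)
      (by rw [← h]; simp only [cross, Pi.sub_apply]; ring)
    have hw : w ≠ 0 := by
      rintro rfl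
      simp [cross] at h
    rw [show a + w - (a + u) = w - u by abel, show a - (a + w) = -w by abel,
      add_sub_cancel_left, latticePoint_add, latticePoint_add, add_dotProduct, add_dotProduct,
      Real.exp_add, Real.exp_add]
    simp only [e]
    rw [edgeValue_neg hw, ← latticePoint_dot w]
    rw [add_sub_cancel, ← latticePoint_dot, ← latticePoint_dot, latticePoint_sub, sub_dotProduct,
      add_sub_cancel] at hs
    rw [← hs]
    have hE : Real.exp (latticePoint w ⬝ᵥ x) * Real.exp (-(latticePoint w ⬝ᵥ x)) = 1 := by
      rw [← Real.exp_add, add_neg_cancel, Real.exp_zero]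
    generalize edgeValue _ _ _ _ _ w = ew
    linear_combination (-Real.exp (latticePoint a ⬝ᵥ x) * ew) * hE
  refine ⟨boundarySum ψ, isSimpleValuation_boundarySum hψ hneg, fun Φ a => ?_⟩
  rw [image_standardTriangle, affineAct_eq]
  rcases det_eq_one_or_neg_one Φ with h | h
  · exact htri (by rw [cross_col, h])
  -- Determinant -1 reverses the orientation; exchanging two vertices restores it, and the symmetry
  -- of `f` absorbs the exchange.
  · have hset : ({latticePoint a, latticePoint (a + Φ.val.col 0),
        latticePoint (a + Φ.val.col 1)} : Set Plane) = {latticePoint a,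
          latticePoint (a + Φ.val.col 1), latticePoint (a + Φ.val.col 0)} := by
      ext; simp; tauto
    have hsymm := hf.symm (latticePoint (Φ.val.col 0) ⬝ᵥ x) (latticePoint (Φ.val.col 1) ⬝ᵥ x)
    rw [hset, hsymm]
    refine htri ?_
    have := cross_col Φ
    rw [h] at this
    simp only [cross] at this ⊢
    linarith

end pointwise

/-! ### Area and the valuation at the origin -/

theorem isSimpleValuation_volume (c : ℝ) :
    IsSimpleValuation fun P => c * (volume : Measure Plane).real P := by
  refine ⟨fun P Q hP hQ _ => ?_, fun P hP hdim => ?_⟩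
  · rw [← mul_add, ← mul_add, measureReal_union_add_inter hQ.isClosed.measurableSet
      hP.isCompact.measure_lt_top.ne hQ.isCompact.measure_lt_top.ne]
  · have hne : affineSpan ℝ P ≠ ⊤ := by
      intro h
      have h1 := congrArg AffineSubspace.direction h
      rw [direction_affineSpan, AffineSubspace.direction_top] at h1
      rw [h1, finrank_top] at hdim
      simp at hdim
    have h0 : volume P = 0 := measure_mono_null (subset_affineSpan ℝ P)
      (Measure.addHaar_affineSubspace volume _ hne)
    simp [Measure.real, h0]

theorem volume_standardTriangle_ne_zero :
    (volume : Measure Plane).real LatticePolytope.standardTriangle.1 ≠ 0 := by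
  have hopen : IsOpen {p : Plane | 0 < p 0 ∧ 0 < p 1 ∧ p 0 + p 1 < 1} :=
    (isOpen_lt continuous_const (continuous_apply 0)).inter
      ((isOpen_lt continuous_const (continuous_apply 1)).inter
        (isOpen_lt ((continuous_apply 0).add (continuous_apply 1)) continuous_const))
  have hpos := hopen.measure_pos (volume : Measure Plane)
    ⟨![1 / 4, 1 / 4], by norm_num, by norm_num, by norm_num⟩
  have hsub : {p : Plane | 0 < p 0 ∧ 0 < p 1 ∧ p 0 + p 1 < 1} ⊆
      LatticePolytope.standardTriangle.1 := by
    rintro p ⟨h0, h1, h2⟩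
    have hpos : 0 < p 0 + p 1 := add_pos h0 h1
    have hmem : ∀ q ∈ ({![1, 0], ![0, 1], ![0, 0]} : Set Plane),
        q ∈ LatticePolytope.standardTriangle.1 := fun q hq => subset_convexHull ℝ _ hq
    have hc : Convex ℝ LatticePolytope.standardTriangle.1 := convex_convexHull ℝ _
    have h3 := hc (hmem ![1, 0] (by simp)) (hmem ![0, 1] (by simp))
      (div_nonneg h0.le hpos.le) (div_nonneg h1.le hpos.le) (by field_simp)
    have h4 := hc h3 (hmem ![0, 0] (by simp)) hpos.le (sub_nonneg.2 h2.le) (by ring)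
    convert h4 using 1
    ext i
    fin_cases i <;> simp <;> field_simp
  rw [Measure.real, ENNReal.toReal_ne_zero]
  exact ⟨(hpos.trans_le (measure_mono hsub)).ne',
    LatticePolytope.standardTriangle.2.isCompact.measure_lt_top.ne⟩

theorem volume_image_latticeAffine (Φ : GL (Fin 2) ℤ) (a : Fin 2 → ℤ) (P : Set Plane) :
    (volume : Measure Plane).real (latticeAffine Φ a '' P) = (volume : Measure Plane).real P := by
  have himg : latticeAffine Φ a '' P = (fun y => y + latticePoint a) ''
      (toLin' (Φ.val.map (Int.cast : ℤ → ℝ)) '' P) := by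
    rw [Set.image_image]
    rfl
  have hdet : |(Φ.val.map (Int.cast : ℤ → ℝ)).det| = 1 := by
    have : (Φ.val.map (Int.cast : ℤ → ℝ)).det = (Φ.val.det : ℤ) :=
      ((Int.castRingHom ℝ).map_det Φ.val).symm
    rw [this]
    rcases det_eq_one_or_neg_one Φ with h | h <;> simp [h]
  rw [Measure.real, Measure.real, himg, Set.image_add_right, measure_preimage_add_right,
    Measure.addHaar_image_linearMap, LinearMap.det_toLin', hdet]
  simp

theorem exists_simpleValuation {f : Plane → ℝ} (hf : IsTriangleFun fun s t => f ![s, t])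
    (x : Plane) : ∃ z : Set Plane → ℝ, IsSimpleValuation z ∧
      ∀ (Φ : GL (Fin 2) ℤ) (a : Fin 2 → ℤ),
        z (latticeAffine Φ a '' LatticePolytope.standardTriangle.1) = affineAct Φ a f x := by
  by_cases hx : x = 0
  · subst hx
    -- At the origin all prescribed values equal `f 0`, so area normalized on the standard triangle
    -- works.
    refine ⟨_, isSimpleValuation_volume
      (f 0 / (volume : Measure Plane).real LatticePolytope.standardTriangle.1), fun Φ a => ?_⟩
    rw [volume_image_latticeAffine, div_mul_cancel₀ _ volume_standardTriangle_ne_zero]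
    simp [affineAct]
  · exact exists_simpleValuation_of_ne_zero hf hx

/-! ### Measurability, covariance and uniqueness -/

/-- For Lebesgue measurable `f`, composition requires that preimages of null sets be null;
invertibility of the linear map provides this. -/
theorem aemeasurable_affineAct {f : Plane → ℝ} (hf : AEMeasurable f (volume : Measure Plane))
    (Φ : GL (Fin 2) ℤ) (a : Fin 2 → ℤ) : AEMeasurable (affineAct Φ a f) volume := by
  have hdet : LinearMap.det (toLin' (Φ.val.map (Int.cast : ℤ → ℝ))ᵀ) ≠ 0 := by
    rw [LinearMap.det_toLin', det_transpose]
    have : (Φ.val.map (Int.cast : ℤ → ℝ)).det = (Φ.val.det : ℤ) :=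
      ((Int.castRingHom ℝ).map_det Φ.val).symm
    rw [this]
    rcases det_eq_one_or_neg_one Φ with h | h <;> simp [h]
  have hexp : Continuous fun x : Plane => Real.exp (latticePoint a ⬝ᵥ x) := by
    simp only [dotProduct]
    fun_prop
  exact hexp.aemeasurable.mul (hf.comp_quasiMeasurePreserving
    (Measure.LinearMap.quasiMeasurePreserving volume _ hdet))

/-- A simple valuation on lattice polytopes is determined by its values at unimodular triangles. -/
theorem IsSimpleValuation.eq_of_eq_unimodular {z z' : Set Plane → ℝ} (hz : IsSimpleValuation z)
    (hz' : IsSimpleValuation z') (h : ∀ (Φ : GL (Fin 2) ℤ) (a : Fin 2 → ℤ),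
      z (latticeAffine Φ a '' LatticePolytope.standardTriangle.1) =
        z' (latticeAffine Φ a '' LatticePolytope.standardTriangle.1))
    {P : Set Plane} (hP : IsLatticePolytope P) : z P = z' P := by
  obtain ⟨L, hL⟩ := hP.hasTriangulation
  rw [hL z hz, hL z' hz']
  simp only [h]

open Classical in
/-- The values at a point of a map on lattice polytopes, as a function of sets. -/
noncomputable def evalAt (Z : LatticePolytope → LebesgueMeasurableFun) (x : Plane)
    (P : Set Plane) : ℝ :=
  if h : IsLatticePolytope P then (Z ⟨P, h⟩).1 x else 0

theorem evalAt_apply (Z : LatticePolytope → LebesgueMeasurableFun) (x : Plane)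
    (P : LatticePolytope) : evalAt Z x P.1 = (Z P).1 x := dif_pos P.2

theorem isSimpleValuation_evalAt {Z : LatticePolytope → LebesgueMeasurableFun}
    (hval : IsValuation Z) (hsimple : IsSimple Z) (x : Plane) :
    IsSimpleValuation (evalAt Z x) := by
  refine ⟨fun P Q hP hQ hc => ?_, fun P hP hdim => ?_⟩
  · have := hval ⟨P, hP⟩ ⟨Q, hQ⟩ hc x
    rwa [← evalAt_apply, ← evalAt_apply, ← evalAt_apply, ← evalAt_apply] at this
  · have := hsimple ⟨P, hP⟩ hdim x
    rwa [← evalAt_apply] at this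

theorem latticeAffine_injective (Φ : GL (Fin 2) ℤ) (a : Fin 2 → ℤ) :
    Function.Injective (latticeAffine Φ a) := by
  have hdet : IsUnit (Φ.val.map (Int.cast : ℤ → ℝ)).det := by
    have : (Φ.val.map (Int.cast : ℤ → ℝ)).det = (Φ.val.det : ℤ) :=
      ((Int.castRingHom ℝ).map_det Φ.val).symm
    rw [this, isUnit_iff_ne_zero]
    rcases det_eq_one_or_neg_one Φ with h | h <;> simp [h]
  exact (add_left_injective (latticePoint a)).comp
    (mulVec_injective_iff_isUnit.2 ((isUnit_iff_isUnit_det _).2 hdet))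

theorem latticePoint_zero : latticePoint 0 = 0 := by
  ext i; simp [latticePoint]

theorem latticeAffine_comp (Φ Ψ : GL (Fin 2) ℤ) (a b : Fin 2 → ℤ) (x : Plane) :
    latticeAffine Φ a (latticeAffine Ψ b x) = latticeAffine (Φ * Ψ) (Φ.val *ᵥ b + a) x := by
  ext i
  simp only [latticeAffine, latticePoint, Pi.add_apply, mulVec, dotProduct, Fin.sum_univ_two,
    Matrix.map_apply, Units.val_mul, Matrix.mul_apply]
  push_cast
  ring

theorem affineAct_comp (Φ Ψ : GL (Fin 2) ℤ) (a b : Fin 2 → ℤ) (f : Plane → ℝ) (x : Plane) :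
    affineAct Φ a (affineAct Ψ b f) x = affineAct (Φ * Ψ) (Φ.val *ᵥ b + a) f x := by
  simp only [affineAct]
  rw [← mul_assoc, ← Real.exp_add]
  congr 2
  · simp [latticePoint, mulVec, dotProduct]; ring
  · ext i
    fin_cases i <;> simp [mulVec, dotProduct, Matrix.mul_apply] <;> ring

theorem IsSimpleValuation.comp_image {z : Set Plane → ℝ} (hz : IsSimpleValuation z)
    (Φ : GL (Fin 2) ℤ) (a : Fin 2 → ℤ) : IsSimpleValuation fun P => z (latticeAffine Φ a '' P) := by
  let g : Plane →ᵃ[ℝ] Plane :=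
    (Matrix.mulVecLin (Φ.val.map (Int.cast : ℤ → ℝ))).toAffineMap +
      AffineMap.const ℝ Plane (latticePoint a)
  have hg : ⇑g = latticeAffine Φ a := by
    ext x i
    simp [g, latticeAffine]
  refine ⟨fun P Q hP hQ hc => ?_, fun P hP hdim => ?_⟩
  · rw [Set.image_inter (latticeAffine_injective Φ a), Set.image_union]
    refine hz.union_add_inter _ _ (hP.image_latticeAffine Φ a) (hQ.image_latticeAffine Φ a) ?_
    rw [← Set.image_union, ← hg]
    exact hc.affine_image g
  · refine hz.simple _ (hP.image_latticeAffine Φ a) ?_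
    rw [← hg, ← AffineMap.map_vectorSpan]
    exact (Submodule.finrank_map_le _ _).trans hdim

theorem IsSimpleValuation.const_mul {z : Set Plane → ℝ} (hz : IsSimpleValuation z) (c : ℝ) :
    IsSimpleValuation fun P => c * z P :=
  ⟨fun P Q hP hQ hc => by rw [← mul_add, ← mul_add, hz.union_add_inter P Q hP hQ hc],
    fun P hP hdim => by rw [hz.simple P hP hdim, mul_zero]⟩

theorem mainTheorem4 (f₂ : Plane → ℝ) (hmeas : NullMeasurable f₂ (volume : Measure Plane))
    (hrot : ∀ x y : ℝ, f₂ ![-x + y, -x] = Real.exp (-x) * f₂ ![x, y])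
    (hsquare : ∀ x y : ℝ,
      f₂ ![x, y] + Real.exp (x + y) * f₂ ![-x, -y] = f₂ ![x, x + y] + f₂ ![x + y, y])
    (hsymm : ∀ x y : ℝ, f₂ ![x, y] = f₂ ![y, x]) :
    ∃! Z : LatticePolytope → LebesgueMeasurableFun,
      IsValuation Z ∧ IsSimple Z ∧ IsAffineCovariant Z ∧
        (Z LatticePolytope.standardTriangle).1 = f₂ := by
  choose z hz hzT using exists_simpleValuation (f := f₂) ⟨hrot, hsquare, hsymm⟩
  have hZmeas : ∀ P : LatticePolytope, NullMeasurable (fun x => z x P.1) volume := by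
    intro P
    -- The list `L` serves all `x` at once, so the pointwise choice of `z` does no harm to
    -- measurability.
    obtain ⟨L, hL⟩ := P.2.hasTriangulation
    have heq : (fun x => z x P.1) = fun x => (L.map fun g => affineAct g.1 g.2 f₂ x).sum := by
      funext x
      rw [hL (z x) (hz x)]
      simp only [hzT]
    rw [heq]
    refine AEMeasurable.nullMeasurable ?_
    clear hL heq
    induction L with
    | nil => simp
    | cons g L ih =>
      simp only [List.map_cons, List.sum_cons]
      exact (aemeasurable_affineAct hmeas.aemeasurable g.1 g.2).add ih
  have hid : ∀ P : Set Plane, latticeAffine 1 0 '' P = P := by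
    intro P
    have : latticeAffine 1 0 = id := by
      funext x
      simp [latticeAffine, latticePoint_zero]
    rw [this, Set.image_id]
  refine ⟨fun P => ⟨fun x => z x P.1, hZmeas P⟩, ⟨?_, ?_, ?_, ?_⟩, ?_⟩
  · exact fun P Q h x => (hz x).union_add_inter P.1 Q.1 P.2 Q.2 h
  · exact fun P hP x => (hz x).simple P.1 P.2 hP
  · intro Φ a P x
    -- Both sides are simple valuations in `P`; on unimodular triangles the claim is the composition
    -- law `affineAct_comp`.
    refine ((hz x).comp_image Φ a).eq_of_eq_unimodular ((hz _).const_mul _) ?_ P.2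
    intro Ψ b
    simp only [Set.image_image, latticeAffine_comp]
    rw [hzT, hzT, ← affineAct_comp]
    rfl
  · funext x
    have := hzT x 1 0
    rw [hid] at this
    simp only [this]
    simp [affineAct, latticePoint_zero]
  · rintro Z ⟨hval, hsimple, hcov, hT⟩
    funext P
    apply Subtype.ext
    funext x
    rw [← evalAt_apply]
    refine (isSimpleValuation_evalAt hval hsimple x).eq_of_eq_unimodular (hz x) ?_ P.2
    intro Φ a
    rw [hzT, ← hT]
    exact (evalAt_apply Z x (LatticePolytope.image Φ a _)).trans (hcov Φ a _ x)
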